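/- Let $k$ be an algebraically closed field of characteristic $0$. A variety is a reduced separated scheme of finite type over $k$ (not necessarily irreducible); complete means proper over $k$; points are $k$-points. Let $p$ be a prime, let $n,e\ge 0$ be integers, and let $H$ be a finite abelian group of order $p^n$. An $H$-variety is a variety with an action of $H$ by $k$-automorphisms, and a rational map of $H$-varieties is an $H$-equivariant rational map over $k$, defined on a dense open subset. Theorem (Going up). Let $f\colon X\dashrightarrow Y$ be a rational map of $H$-varieties such that (i) $Y$ is irreducible; (ii) $X$ is complete; (iii) $\dim X=\dim Y$ and $f$ is dominant; (iv) $Y$ has a smooth point fixed by $H$; (v) $\deg f$ is not divisible by $p^{e+1}$, where $\deg f=\sum_i [k(X_i):k(Y)]$, the sum being over the irreducible components $X_i$ of $X$ that $f$ maps dominantly to $Y$. Then there is a subgroup $H'$ of $H$ with $|H'|\ge p^{n-e}$ such that (a) $H'$ has a fixed point on $X$; and (b) for every complete $H$-variety $Z$ and every rational map $X\dashrightarrow Z$ of $H$-varieties, $H'$ has a fixed point on $Z$. -/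

import Mathlib

open CategoryTheory AlgebraicGeometry

universe u v

noncomputable section

namespace GoingUp

/-! ### Rational maps -/

section RationalMaps

variable {X' X Y : Scheme.{u}}

/-- Precomposition of a partial map `φ : X ⇢ Y` with an isomorphism `g : X' ⟶ X`; it is defined
on the preimage under `g` of the domain of `φ`. -/
def precompPartial (g : X' ⟶ X) [IsIso g] (φ : X.PartialMap Y) : X'.PartialMap Y where
  domain := g ⁻¹ᵁ φ.domain
  dense_domain := φ.dense_domain.preimage g.homeomorph.isOpenMap
  hom := (g ∣_ φ.domain) ≫ φ.hom

/-- Precomposition of a rational map `f : X ⇢ Y` with an isomorphism `g : X' ⟶ X`. -/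
def precomp (g : X' ⟶ X) [IsIso g] (f : X ⤏ Y) : X' ⤏ Y :=
  Quotient.map (precompPartial g) (by
    rintro φ ψ ⟨W, hW, hWl, hWr, e⟩
    refine ⟨g ⁻¹ᵁ W, hW.preimage g.homeomorph.isOpenMap, fun x hx => hWl hx,
      fun x hx => hWr hx, ?_⟩
    simp only [Scheme.PartialMap.restrict_hom] at e ⊢
    change X'.homOfLE _ ≫ (g ∣_ φ.domain) ≫ φ.hom = X'.homOfLE _ ≫ (g ∣_ ψ.domain) ≫ ψ.hom
    have key : ∀ (V : X.Opens) (hV : W ≤ V) (hV' : g ⁻¹ᵁ W ≤ g ⁻¹ᵁ V),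
        X'.homOfLE hV' ≫ (g ∣_ V) = (g ∣_ W) ≫ X.homOfLE hV := by
      intro V hV hV'
      rw [← cancel_mono V.ι]
      simp
    have key' : ∀ (V : X.Opens) (hV : W ≤ V) (hV' : g ⁻¹ᵁ W ≤ g ⁻¹ᵁ V) (t : V.toScheme ⟶ Y),
        X'.homOfLE hV' ≫ (g ∣_ V) ≫ t = (g ∣_ W) ≫ X.homOfLE hV ≫ t := by
      intro V hV hV' t
      rw [← Category.assoc, key V hV hV', Category.assoc]
    exact (key' _ hWl (g.preimage_mono hWl) _).trans
      ((congrArg _ e).trans (key' _ hWr (g.preimage_mono hWr) _).symm)) f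

/-- The degree of a partial map `φ : X ⇢ Y` to an irreducible scheme: the sum, over the irreducible
components `Xᵢ` of (the domain of) `X` which dominate `Y`, of the degrees of the extensions of
function fields `k(Xᵢ) / k(Y)`. A component is given by its generic point `ξ`; it dominates `Y` when
`φ ξ` is the generic point of `Y`. For reduced schemes the local rings at `ξ` and at `φ ξ` are the
function fields `k(Xᵢ)` and `k(Y)`, and the field extension is the map on stalks. -/
def partialDegree [IrreducibleSpace Y] (φ : X.PartialMap Y) : ℕ :=
  ∑ᶠ ξ : {ξ : φ.domain.toScheme //
      ξ ∈ genericPoints φ.domain.toScheme ∧ φ.hom ξ = genericPoint Y},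
    letI := (φ.hom.stalkMap ξ.1).hom.toAlgebra
    Module.finrank (Y.presheaf.stalk (φ.hom ξ.1)) (φ.domain.toScheme.presheaf.stalk ξ.1)

/-- The degree of a rational map to an irreducible scheme. For varieties it does not depend on
the representative, since a dense open set contains all generic points of components. -/
def degree [IrreducibleSpace Y] (f : X ⤏ Y) : ℕ := partialDegree f.representative

end RationalMaps

/-! ### Varieties with a group action -/

section Varieties

/-- A variety over `k`: a reduced separated scheme of finite type over `k`,
not necessarily irreducible. -/
class IsVariety {k : Type u} [Field k] (X : Over (Spec (CommRingCat.of k))) : Prop where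
  isReduced : IsReduced X.left
  isSeparated : IsSeparated X.hom
  locallyOfFiniteType : LocallyOfFiniteType X.hom
  quasiCompact : QuasiCompact X.hom

variable (k : Type u) [Field k] (H : Type v) [Group H]

/-- An `H`-variety over `k`, for an abstract (in practice finite) group `H`: a variety over `k` with
an action of `H` by automorphisms over `k`. -/
structure GVariety where
  /-- the underlying variety -/
  obj : Over (Spec (CommRingCat.of k))
  isVariety : IsVariety obj
  /-- the action -/
  ρ : H →* End obj

variable {k H}

namespace GVariety

/-- The underlying scheme of an `H`-variety. -/
abbrev scheme (X : GVariety k H) : Scheme.{u} := X.obj.left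

/-- The morphism `X ⟶ X` by which `h` acts. -/
def act (X : GVariety k H) (h : H) : X.obj ⟶ X.obj := X.ρ h

lemma act_comp_act_inv (X : GVariety k H) (h : H) : X.act h ≫ X.act h⁻¹ = 𝟙 X.obj := by
  have := X.ρ.map_mul h⁻¹ h
  rw [inv_mul_cancel, map_one] at this
  exact this.symm

instance (X : GVariety k H) (h : H) : IsIso (X.act h) :=
  ⟨X.act h⁻¹, X.act_comp_act_inv h, by simpa using X.act_comp_act_inv h⁻¹⟩

instance (X : GVariety k H) (h : H) : IsIso (X.act h).left :=
  inferInstanceAs (IsIso ((Over.forget _).map (X.act h)))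

/-- An `H`-variety is complete if it is proper over `k`. -/
def IsComplete (X : GVariety k H) : Prop := IsProper X.obj.hom

/-- The `k`-points of `X`. When `k` is algebraically closed these are the closed points of `X`. -/
abbrev Point (X : GVariety k H) : Type u := Over.mk (𝟙 (Spec (CommRingCat.of k))) ⟶ X.obj

/-- The point `x` of `X` is fixed by the subgroup `K` of `H`. -/
def IsFixedBy (X : GVariety k H) (K : Subgroup H) (x : X.Point) : Prop :=
  ∀ h ∈ K, x ≫ X.act h = x

/-- The point `x` of `X` is a smooth point: some open neighbourhood of it is smooth over `k`. -/
def IsSmoothAt (X : GVariety k H) (x : X.Point) : Prop :=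
  ∃ U : X.scheme.Opens, x.left (IsLocalRing.closedPoint k) ∈ U ∧ Smooth (U.ι ≫ X.obj.hom)

/-- A rational map `f : X ⇢ Y` between the underlying schemes is a rational map of `H`-varieties
if it is defined over `k` and `H`-equivariant, i.e. `f ∘ h = h ∘ f` for all `h` in `H`. -/
structure IsRationalMap (X Y : GVariety k H) (f : X.scheme ⤏ Y.scheme) : Prop where
  isOver : f.compHom Y.obj.hom = Scheme.Hom.toRationalMap X.obj.hom
  equivariant : ∀ h : H, precomp (X.act h).left f = f.compHom (Y.act h).left

end GVariety

end Varieties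

end GoingUp

end

/-!
Resolution of singularities is avoided: the argument is an induction on the dimension of `Y` at the
fixed smooth point `y`, carried out with discrete valuation rings.

Since the degree of `f` is a sum over the components of `X` dominating `Y`, and `H` permutes these
components without changing their degrees, some component has a stabilizer `S` such that the index
of `S` times the degree of the component over `Y` is not divisible by `p ^ (e + 1)`
(`exists_not_dvd_index_stabilizer_mul`). Everything that remains concerns the local ring `R` of `Y`
at `y`, its fraction field `K`, and the finite extension `L` of `K` given by the function field of
the component. A rational map from `X` to `Z` becomes an equivariant morphism `Spec L ⟶ Z`, and the
identity of `X` is one of them; so both claims follow from the statement that a subgroup whose index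
is controlled by `[L : K]` fixes a `k`-point of every proper `Z` receiving an equivariant morphism
from `Spec L` (`exists_subgroup_fixing_points`).

For the inductive step, a finite abelian group acting linearly on a vector space over `k` is
diagonalizable, so `𝔪 \ 𝔪²` contains an eigenvector `t` of the group
(`exists_eigenvector_notMem`). The germ `R ⧸ (t)` is again smooth and the group acts on it. The
localization `A` of `R` at `(t)` is a discrete valuation ring with residue field `K' = Frac (R ⧸ t)`.
Over its maximal ideal, the integral closure `B` of `A` in `L` has finitely many primes `P`, permuted
by the group, and `[L : K]` is the sum of the products of ramification index and inertia degree. So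
again some `P` has a stabilizer whose index, times the degree of `L' = B ⧸ P` over `K'`, retains the
divisibility bound (`exists_prime_not_dvd_index_mul_finrank`). By the valuative criterion of
properness a morphism `Spec L ⟶ Z` extends over the discrete valuation ring `B_P`, and restricts to
`Spec L' ⟶ Z`, equivariantly for the stabilizer (`exists_specialization`). Now
`(R ⧸ t, K', L')` replaces `(R, K, L)`. At the end `R` is `k`, hence so is `L`, and a morphism
`Spec L ⟶ Z` is a `k`-point.

Smoothness enters only through the lifting of tangent vectors at `y` to derivations of `R`
(`TangentVectorsLift`), which passes to `R ⧸ (t)` and in characteristic zero makes a Noetherian local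
ring a domain (`TangentVectorsLift.isDomain`); this replaces the theory of regular local rings.
The subgroups and the choices of components are made before `Z` is considered, so that a single
subgroup serves for all `Z`.
-/

noncomputable section

namespace GoingUp

open IsLocalRing

/-! ### Eigenvectors of finite abelian groups -/

/-- A stable subspace `S` which is not contained in `W` contains a common eigenvector outside `W`: in
the decomposition of an element of `S` into its components for the characters of `G`, some component
is not in `W`. -/
theorem exists_eigenvector_notMem {k V G : Type*} [Field k] [IsAlgClosed k] [CharZero k]
    [CommGroup G] [Finite G] [AddCommGroup V] [Module k V] (σ : G → V →ₗ[k] V)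
    (hσ : ∀ g h x, σ (g * h) x = σ g (σ h x)) (hσ1 : ∀ x, σ 1 x = x)
    {S W : Submodule k V} (hS : ∀ g, ∀ x ∈ S, σ g x ∈ S) (hSW : ¬ S ≤ W) :
    ∃ t ∈ S, t ∉ W ∧ ∀ g, ∃ c : k, σ g t = c • t := by
  have := Fintype.ofFinite G
  have : Finite (G →* kˣ) :=
    .of_equiv G (CommGroup.monoidHom_mulEquiv_of_hasEnoughRootsOfUnity G k).some.symm.toEquiv
  have := Fintype.ofFinite (G →* kˣ)
  obtain ⟨x, hxS, hxW⟩ := SetLike.not_le_iff_exists.mp hSW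
  let e : (G →* kˣ) → V := fun χ ↦ ∑ h, ((χ h)⁻¹ : kˣ) • σ h x
  have heS (χ) : e χ ∈ S := S.sum_mem fun h _ ↦ S.smul_mem _ (hS h x hxS)
  have heig (χ) (g : G) : σ g (e χ) = (χ g : k) • e χ := by
    simp only [e, map_sum, Finset.smul_sum]
    refine Fintype.sum_equiv (Equiv.mulLeft g) _ _ fun h ↦ ?_
    simp only [Equiv.coe_mulLeft]
    rw [Units.smul_def, Units.smul_def, map_smul, ← hσ, smul_smul,
      map_mul, mul_inv, ← Units.val_mul, mul_inv_cancel_left]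
  -- orthogonality of the characters of `G`
  have horth (h : G) (hh : h ≠ 1) : ∑ χ : G →* kˣ, (((χ h)⁻¹ : kˣ) : k) = 0 := by
    obtain ⟨ψ, hψ⟩ := CommGroup.exists_apply_ne_one_of_hasEnoughRootsOfUnity G k hh
    have key : ∑ χ : G →* kˣ, (((χ h)⁻¹ : kˣ) : k) =
        (((ψ h)⁻¹ : kˣ) : k) * ∑ χ : G →* kˣ, (((χ h)⁻¹ : kˣ) : k) := by
      rw [Finset.mul_sum]
      refine (Fintype.sum_equiv (Equiv.mulLeft ψ) _ _ fun χ ↦ ?_).symm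
      simp [mul_comm]
    have h1 : (((ψ h)⁻¹ : kˣ) : k) - 1 ≠ 0 := by
      rw [sub_ne_zero, Ne, Units.val_eq_one, inv_eq_one]
      exact hψ
    refine (mul_eq_zero.mp (?_ : ((((ψ h)⁻¹ : kˣ) : k) - 1) * _ = 0)).resolve_left h1
    rw [sub_mul, one_mul, ← key, sub_self]
  have hsum : ∑ χ, e χ = (Fintype.card (G →* kˣ) : k) • x := by
    simp only [e]
    rw [Finset.sum_comm]
    simp only [Units.smul_def, ← Finset.sum_smul]
    rw [Finset.sum_eq_single 1 (fun h _ hh ↦ by rw [horth h hh, zero_smul]) (by simp)]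
    simp [hσ1]
  by_contra! H
  refine hxW ?_
  have hmem : (Fintype.card (G →* kˣ) : k) • x ∈ W := by
    rw [← hsum]
    refine W.sum_mem fun χ _ ↦ ?_
    by_contra hχ
    obtain ⟨g, hg⟩ := H _ (heS χ) hχ
    exact hg _ (heig χ g)
  exact (W.smul_mem_iff (by simp)).mp hmem

/-! ### Local rings on which tangent vectors lift to derivations -/

section TangentVectors

variable {k R : Type*} [Field k] [CommRing R] [Algebra k R] [IsLocalRing R]

theorem mem_maximalIdeal_iff_eq_zero (ε : R →ₐ[k] k) {x : R} : x ∈ maximalIdeal R ↔ ε x = 0 := by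
  have hle : RingHom.ker ε ≤ maximalIdeal R :=
    le_maximalIdeal (RingHom.ker_ne_top _)
  refine ⟨fun hx ↦ ?_, fun hx ↦ hle hx⟩
  have h1 : x - algebraMap k R (ε x) ∈ maximalIdeal R := hle (by simp [RingHom.mem_ker])
  have h2 : algebraMap k R (ε x) ∈ maximalIdeal R := by
    simpa using (maximalIdeal R).sub_mem hx h1
  by_contra h
  exact h2 ((IsUnit.mk0 _ h).map _)

variable (k R) in
/-- Every tangent vector at the closed point of `Spec R`, given as a linear form `l` on `R` which
vanishes on `𝔪²` and is only looked at on `𝔪`, is the value of a global vector field, i.e. of a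
`k`-derivation of `R`. For a local ring of a variety at a `k`-point this expresses smoothness. -/
def TangentVectorsLift : Prop :=
  ∀ l : R →ₗ[k] k, (∀ x ∈ maximalIdeal R ^ 2, l x = 0) →
    ∃ D : Derivation k R R, ∀ x ∈ maximalIdeal R, D x - algebraMap k R (l x) ∈ maximalIdeal R

/-- A linear form on `𝔪 / 𝔪²` is a derivation from `R` to the residue field `k`; when `Ω[R⁄k]` is
projective, it lifts along the surjection from `R` to `k`. -/
theorem TangentVectorsLift.of_projective [Module.Projective R (Ω[R⁄k])] (ε : R →ₐ[k] k) :
    TangentVectorsLift k R := by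
  intro l hl
  let : Module R k := Module.compHom k ε.toRingHom
  have hsmul (r : R) (c : k) : r • c = ε r * c := rfl
  have : IsScalarTower k R k := ⟨fun a r c ↦ by simp [hsmul, mul_assoc]⟩
  let δ : Derivation k R k := Derivation.mk'
    (l ∘ₗ (LinearMap.id - (Algebra.linearMap k R) ∘ₗ ε.toLinearMap)) (by
      intro a b
      simp only [LinearMap.comp_apply, LinearMap.sub_apply, LinearMap.id_apply,
        AlgHom.toLinearMap_apply, Algebra.linearMap_apply, hsmul]
      have h1 : (a - algebraMap k R (ε a)) * (b - algebraMap k R (ε b)) ∈ maximalIdeal R ^ 2 := by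
        rw [pow_two]
        exact Ideal.mul_mem_mul ((mem_maximalIdeal_iff_eq_zero ε).mpr (by simp))
          ((mem_maximalIdeal_iff_eq_zero ε).mpr (by simp))
      have h2 : a * b - algebraMap k R (ε (a * b)) =
          (a - algebraMap k R (ε a)) * (b - algebraMap k R (ε b)) +
          (ε a • (b - algebraMap k R (ε b)) + ε b • (a - algebraMap k R (ε a))) := by
        simp only [Algebra.smul_def, map_mul]
        ring
      rw [h2, map_add, hl _ h1, zero_add, map_add, map_smul, map_smul, smul_eq_mul, smul_eq_mul])
  let π : R →ₗ[R] k := LinearMap.toSpanSingleton R k 1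
  have hπ (r : R) : π r = ε r := by simp [π, hsmul]
  have hsurj : Function.Surjective π := fun c ↦ ⟨algebraMap k R c, by simp [hπ]⟩
  obtain ⟨F, hF⟩ := Module.projective_lifting_property π δ.liftKaehlerDifferential hsurj
  refine ⟨F.compDer (KaehlerDifferential.D k R), fun x hx ↦ ?_⟩
  rw [mem_maximalIdeal_iff_eq_zero ε] at hx ⊢
  have h3 : ε (F (KaehlerDifferential.D k R x)) = δ x := by
    rw [← hπ, ← LinearMap.comp_apply, hF, Derivation.liftKaehlerDifferential_comp_D]
  have h4 : δ x = l x := by simp [δ, hx]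
  simp [h3, h4]

/-- A derivation which does not kill `t` to first order detects that `t ∉ 𝔪²`. -/
theorem TangentVectorsLift.exists_isUnit (h : TangentVectorsLift k R) {t : R}
    (ht : t ∈ maximalIdeal R) (ht' : t ∉ maximalIdeal R ^ 2) :
    ∃ D : Derivation k R R, IsUnit (D t) := by
  obtain ⟨l, hl, hl'⟩ := Submodule.exists_le_ker_of_notMem
    (p := (maximalIdeal R ^ 2).restrictScalars k) ht'
  obtain ⟨D, hD⟩ := h l fun x hx ↦ hl' hx
  refine ⟨D, ?_⟩
  by_contra hn
  have h1 : algebraMap k R (l t) ∈ maximalIdeal R := by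
    simpa using (maximalIdeal R).sub_mem hn (hD t ht)
  exact h1 ((IsUnit.mk0 _ hl).map _)

/-- A hypersurface `t = 0` which is not singular at the closed point inherits the lifting of tangent
vectors. -/
theorem TangentVectorsLift.quotient (h : TangentVectorsLift k R) {t : R}
    (ht : t ∈ maximalIdeal R) (ht' : t ∉ maximalIdeal R ^ 2) [IsLocalRing (R ⧸ Ideal.span {t})] :
    TangentVectorsLift k (R ⧸ Ideal.span {t}) := by
  intro l hl
  have hmk : Function.Surjective (Ideal.Quotient.mk (Ideal.span {t})) :=
    Ideal.Quotient.mk_surjective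
  have := IsLocalHom.of_surjective _ hmk
  have hmem {x : R} : Ideal.Quotient.mk (Ideal.span {t}) x ∈ maximalIdeal (R ⧸ Ideal.span {t}) ↔
      x ∈ maximalIdeal R := by
    simp [mem_maximalIdeal, mem_nonunits_iff]
  have hmap : (maximalIdeal R).map (Ideal.Quotient.mk (Ideal.span {t})) ≤
      maximalIdeal (R ⧸ Ideal.span {t}) :=
    Ideal.map_le_iff_le_comap.mpr fun x hx ↦ hmem.mpr hx
  obtain ⟨D, hD⟩ := h (l ∘ₗ (Ideal.Quotient.mkₐ k (Ideal.span {t})).toLinearMap) (by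
    intro x hx
    refine hl _ (Ideal.pow_right_mono hmap 2 ?_)
    rw [← Ideal.map_pow]
    exact Ideal.mem_map_of_mem _ hx)
  obtain ⟨D₁, u, hu⟩ := h.exists_isUnit ht ht'
  -- correct `D` by a multiple of `D₁` so that it kills `t`
  let D' : Derivation k R R := D - (D t * ↑u⁻¹) • D₁
  have hD't : D' t = 0 := by
    simp [D', ← hu, mul_assoc]
  have hDt : D t ∈ maximalIdeal R := by
    have := hD t ht
    have h0 : Ideal.Quotient.mk (Ideal.span {t}) t = 0 :=
      Ideal.Quotient.eq_zero_iff_mem.mpr (Ideal.mem_span_singleton_self t)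
    simpa [h0] using this
  have hker : ∀ x ∈ Ideal.span {t}, D' x ∈ Ideal.span {t} := by
    intro x hx
    obtain ⟨a, rfl⟩ := Ideal.mem_span_singleton'.mp hx
    rw [D'.leibniz, hD't, smul_zero, zero_add, smul_eq_mul]
    exact Ideal.mul_mem_right _ _ (Ideal.mem_span_singleton_self t)
  let F : (R ⧸ Ideal.span {t}) →ₗ[k] (R ⧸ Ideal.span {t}) :=
    Submodule.mapQ ((Ideal.span {t}).restrictScalars k) ((Ideal.span {t}).restrictScalars k)
      D'.toLinearMap hker
  have hF (x : R) : F (Ideal.Quotient.mk _ x) = Ideal.Quotient.mk _ (D' x) := rfl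
  refine ⟨Derivation.mk' F ?_, ?_⟩
  · intro a b
    obtain ⟨a, rfl⟩ := hmk a
    obtain ⟨b, rfl⟩ := hmk b
    rw [← map_mul, hF, hF, hF, D'.leibniz, map_add, smul_eq_mul, smul_eq_mul, map_mul, map_mul]
    rfl
  · intro x hx
    obtain ⟨x, rfl⟩ := hmk x
    have hx' := hmem.mp hx
    have h1 : D' x - algebraMap k R (l (Ideal.Quotient.mk _ x)) ∈ maximalIdeal R := by
      have h2 : D' x - algebraMap k R (l (Ideal.Quotient.mk _ x)) =
          (D x - algebraMap k R (l (Ideal.Quotient.mk _ x))) - D t * (↑u⁻¹ * D₁ x) := by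
        simp [D', mul_assoc]
        ring
      rw [h2]
      exact (maximalIdeal R).sub_mem (hD x hx') (Ideal.mul_mem_right _ _ hDt)
    have h3 := hmem.mpr h1
    rw [map_sub] at h3
    exact h3

theorem isLocalRing_quotient_span_singleton {t : R} (ht : t ∈ maximalIdeal R) :
    IsLocalRing (R ⧸ Ideal.span {t}) := by
  have : Nontrivial (R ⧸ Ideal.span {t}) := Ideal.Quotient.nontrivial_iff.mpr
    (ne_top_of_le_ne_top (Ideal.IsPrime.ne_top' (I := maximalIdeal R))
      ((Ideal.span_singleton_le_iff_mem _).mpr ht))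
  exact .of_surjective' (Ideal.Quotient.mk (Ideal.span {t})) Ideal.Quotient.mk_surjective

/-- Dividing by an element of `𝔪 \ 𝔪²` saves a generator of the maximal ideal. -/
theorem exists_span_maximalIdeal_quotient {n : ℕ} {t : R} (ht : t ∈ maximalIdeal R)
    (ht' : t ∉ maximalIdeal R ^ 2) [IsLocalRing (R ⧸ Ideal.span {t})]
    (hs : ∃ f : Fin (n + 1) → R, maximalIdeal R = Ideal.span (Set.range f)) :
    ∃ f : Fin n → R ⧸ Ideal.span {t},
      maximalIdeal (R ⧸ Ideal.span {t}) = Ideal.span (Set.range f) := by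
  obtain ⟨f, hf⟩ := hs
  obtain ⟨a, ha⟩ := (Ideal.mem_span_range_iff_exists_fun).mp (hf ▸ ht)
  have hfm (i) : f i ∈ maximalIdeal R := hf ▸ Ideal.subset_span ⟨i, rfl⟩
  obtain ⟨i, hi⟩ : ∃ i, IsUnit (a i) := by
    by_contra! H
    refine ht' ?_
    rw [← ha, pow_two]
    exact Ideal.sum_mem _ fun i _ ↦ Ideal.mul_mem_mul (H i) (hfm i)
  obtain ⟨b, hb⟩ := hi.exists_left_inv
  let π := Ideal.Quotient.mk (Ideal.span {t})
  have hπ : Function.Surjective π := Ideal.Quotient.mk_surjective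
  refine ⟨fun j ↦ π (f (i.succAbove j)), ?_⟩
  have := IsLocalHom.of_surjective π hπ
  have hm : maximalIdeal (R ⧸ Ideal.span {t}) = (maximalIdeal R).map π := by
    refine le_antisymm (fun x hx ↦ ?_)
      (Ideal.map_le_iff_le_comap.mpr fun x hx ↦ map_nonunit π x hx)
    obtain ⟨x, rfl⟩ := hπ x
    refine Ideal.mem_map_of_mem _ ?_
    simpa [mem_maximalIdeal, mem_nonunits_iff] using hx
  rw [hm, hf, Ideal.map_span, ← Set.range_comp]
  refine le_antisymm (Ideal.span_le.mpr ?_) (Ideal.span_mono ?_)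
  · rintro _ ⟨j, rfl⟩
    rcases Fin.eq_self_or_eq_succAbove i j with rfl | ⟨j, rfl⟩
    · -- `f i` is a combination of `t` and the other generators
      have h0 : π t = 0 := Ideal.Quotient.eq_zero_iff_mem.mpr (Ideal.mem_span_singleton_self t)
      have h2 := congrArg π ha
      rw [h0, Fin.sum_univ_succAbove _ j, map_add, add_eq_zero_iff_eq_neg] at h2
      have h1 : π (f j) = π b * π (a j * f j) := by
        rw [← map_mul, ← mul_assoc, hb, one_mul]
      simp only [Function.comp_apply]
      rw [h1, h2, map_sum]
      refine Ideal.mul_mem_left _ _ (neg_mem (Ideal.sum_mem _ fun l _ ↦ ?_))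
      rw [map_mul]
      exact Ideal.mul_mem_left _ _ (Ideal.subset_span ⟨l, rfl⟩)
    · exact Ideal.subset_span ⟨j, rfl⟩
  · rintro _ ⟨j, rfl⟩
    exact ⟨_, rfl⟩

end TangentVectors

theorem not_maximalIdeal_le_sq {R : Type*} [CommRing R] [IsLocalRing R] [IsNoetherianRing R]
    (h : maximalIdeal R ≠ ⊥) : ¬ maximalIdeal R ≤ maximalIdeal R ^ 2 := by
  intro h2
  refine h (Submodule.eq_bot_of_le_smul_of_le_jacobson_bot (maximalIdeal R) _
    (IsNoetherian.noetherian _) ?_ (maximalIdeal_le_jacobson _))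
  rwa [smul_eq_mul, ← pow_two]

/-- In characteristic zero, a vector field which is transverse to `t = 0` shows that nothing outside
`(t)` is killed by a power of `t`, when `(t)` is prime. -/
theorem mem_span_of_mul_pow_eq_zero {k R : Type*} [Field k] [CharZero k] [CommRing R] [Algebra k R]
    {t : R} [hp : (Ideal.span {t}).IsPrime] (D : Derivation k R R) (hD : IsUnit (D t)) (n : ℕ) :
    ∀ s : R, s * t ^ n = 0 → s ∈ Ideal.span {t} := by
  induction n with
  | zero => intro s hs; simp_all
  | succ n ih =>
    intro s hs
    have h1 : s * s * t ^ n = 0 := by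
      have h2 := congrArg D hs
      rw [D.leibniz, D.leibniz_pow, map_zero, smul_eq_mul, smul_eq_mul, Nat.add_sub_cancel] at h2
      have h3 : ((n + 1 : ℕ) : R) * D t * (s * s * t ^ n) = 0 := by
        have := congrArg (s * ·) h2
        simp only [mul_zero, mul_add, nsmul_eq_mul, smul_eq_mul] at this
        have h4 : s * (t ^ (n + 1) * D s) = 0 := by
          rw [← mul_assoc, hs, zero_mul]
        rw [h4, add_zero] at this
        rw [← this]
        ring
      have h5 : IsUnit ((n + 1 : ℕ) : R) := by
        have : IsUnit ((n + 1 : ℕ) : k) := IsUnit.mk0 _ (by exact_mod_cast n.succ_ne_zero)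
        simpa using this.map (algebraMap k R)
      exact ((h5.mul hD).mul_right_eq_zero).mp h3
    exact (hp.mem_or_mem (ih _ h1)).elim id id

/-- By Krull's intersection theorem every nonzero element is a power of `t` times an element outside
`(t)`; the hypothesis keeps products of such elements from vanishing. -/
theorem isDomain_of_isPrime_span_singleton {R : Type*} [CommRing R] [IsLocalRing R]
    [IsNoetherianRing R] {t : R} [hp : (Ideal.span {t}).IsPrime]
    (h : ∀ (n : ℕ) (s : R), s * t ^ n = 0 → s ∈ Ideal.span {t}) : IsDomain R := by
  have hfac (a : R) (ha : a ≠ 0) : ∃ n b, a = b * t ^ n ∧ b ∉ Ideal.span {t} := by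
    have hf : FiniteMultiplicity t a := by
      by_contra hn
      refine ha ?_
      have hb := Ideal.iInf_pow_eq_bot_of_isLocalRing (Ideal.span {t}) hp.ne_top
      rw [← Ideal.mem_bot, ← hb, Ideal.mem_iInf]
      intro i
      rw [Ideal.span_singleton_pow, Ideal.mem_span_singleton]
      exact FiniteMultiplicity.not_iff_forall.mp hn i
    obtain ⟨c, hc, hc'⟩ := hf.exists_eq_pow_mul_and_not_dvd
    exact ⟨_, c, by rw [mul_comm]; exact hc, by rwa [Ideal.mem_span_singleton]⟩
  have : NoZeroDivisors R := ⟨by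
    intro a b hab
    by_contra! H
    obtain ⟨n, a', rfl, ha'⟩ := hfac a H.1
    obtain ⟨m, b', rfl, hb'⟩ := hfac b H.2
    have := h (n + m) (a' * b') (by rw [← hab]; ring)
    exact (hp.mem_or_mem this).elim ha' hb'⟩
  exact NoZeroDivisors.to_isDomain R

/-- The counterpart, for Noetherian local rings on which tangent vectors lift, of the fact that regular
local rings are domains, by induction on the number of generators of the maximal ideal. -/
theorem TangentVectorsLift.isDomain {k : Type u} [Field k] [CharZero k] (n : ℕ) :
    ∀ (R : Type u) [CommRing R] [Algebra k R] [IsLocalRing R] [IsNoetherianRing R],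
      TangentVectorsLift k R → (∃ f : Fin n → R, maximalIdeal R = Ideal.span (Set.range f)) →
      IsDomain R := by
  induction n with
  | zero =>
    intro R _ _ _ _ _ ⟨f, hf⟩
    have : IsField R := isField_iff_maximalIdeal_eq.mpr (by simpa using hf)
    exact this.isDomain
  | succ n ih =>
    intro R _ _ _ _ h hf
    by_cases h0 : maximalIdeal R = ⊥
    · exact (isField_iff_maximalIdeal_eq.mpr h0).isDomain
    obtain ⟨t, ht, ht'⟩ := SetLike.not_le_iff_exists.mp (not_maximalIdeal_le_sq h0)
    have := isLocalRing_quotient_span_singleton ht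
    have := ih _ (h.quotient ht ht') (exists_span_maximalIdeal_quotient ht ht' hf)
    have hp : (Ideal.span {t}).IsPrime := (Ideal.Quotient.isDomain_iff_prime _).mp this
    obtain ⟨D, hD⟩ := h.exists_isUnit ht ht'
    exact isDomain_of_isPrime_span_singleton (mem_span_of_mul_pow_eq_zero D hD)

/-! ### Orbits and invariant weights -/

/-- If a group acts on a set and the total of an invariant weight is not divisible by `q`, then
neither is the contribution of some orbit, i.e. the index of a stabilizer times the weight. The
factor `c` is carried along for use in inductions. -/
theorem exists_not_dvd_index_stabilizer_mul {G S : Type*} [Group G] [MulAction G S] (w : S → ℕ)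
    (hw : ∀ (g : G) s, w (g • s) = w s) (q c : ℕ) (h : ¬ q ∣ c * ∑ᶠ s, w s) :
    ∃ s, ¬ q ∣ c * ((MulAction.stabilizer G s).index * w s) := by
  classical
  by_contra! H
  refine h ?_
  -- for infinite support the sum is `0` by convention, which every `q` divides
  by_cases hfin : (Function.support w).Finite
  · rw [finsum_eq_sum _ hfin, ← Finset.sum_fiberwise_of_maps_to
      (g := fun s ↦ (Quotient.mk (MulAction.orbitRel G S) s))
      (t := hfin.toFinset.image (Quotient.mk (MulAction.orbitRel G S)))
      (fun s hs ↦ Finset.mem_image_of_mem _ hs), Finset.mul_sum]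
    refine Finset.dvd_sum fun o ho ↦ ?_
    obtain ⟨s, hs, rfl⟩ := Finset.mem_image.mp ho
    have hmem (r : S) : Quotient.mk (MulAction.orbitRel G S) r =
        Quotient.mk (MulAction.orbitRel G S) s ↔ r ∈ MulAction.orbit G s :=
      Quotient.eq.trans MulAction.orbitRel_apply
    have hconst (r : S) (hr : r ∈ MulAction.orbit G s) : w r = w s := by
      obtain ⟨g, rfl⟩ := hr
      exact hw g s
    have hs' : w s ≠ 0 := by simpa using hs
    rw [Finset.sum_congr rfl (g := fun _ ↦ w s)
      (fun r hr ↦ hconst r ((hmem r).mp (Finset.mem_filter.mp hr).2)), Finset.sum_const,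
      smul_eq_mul]
    have hcard : (hfin.toFinset.filter fun r ↦ Quotient.mk (MulAction.orbitRel G S) r =
        Quotient.mk (MulAction.orbitRel G S) s).card = (MulAction.stabilizer G s).index := by
      rw [MulAction.index_stabilizer, ← Set.ncard_coe_finset]
      congr 1
      ext r
      simp only [Finset.coe_filter, hmem, Set.Finite.mem_toFinset, Function.mem_support]
      exact ⟨fun hr ↦ hr.2, fun hr ↦ ⟨by rwa [hconst r hr], hr⟩⟩
    rw [hcard]
    exact H s
  · rw [finsum_of_infinite_support hfin, mul_zero]
    exact dvd_zero q

/-! ### Extensions of a discrete valuation ring with a group action -/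

/-- Ramification index and inertia degree do not change under an automorphism of a pair of rings. -/
theorem ramificationIdx_mul_inertiaDeg_comap {A B : Type*} [CommRing A] [CommRing B] [Algebra A B]
    [IsDedekindDomain B] (α : A ≃+* A) (β : B ≃+* B)
    (h : ∀ a, algebraMap A B (α a) = β (algebraMap A B a)) (p : Ideal A) [p.IsMaximal]
    (hα : p.map α = p) (hp : p.map (algebraMap A B) ≠ ⊥) (P P' : Ideal B) [P.IsMaximal]
    [P'.IsMaximal] [P.LiesOver p] [P'.LiesOver p] (hP : P' = P.map β) :
    P'.ramificationIdx A * P'.inertiaDeg A = P.ramificationIdx A * P.inertiaDeg A := by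
  congr 1
  · rw [Ideal.IsDedekindDomain.ramificationIdx_eq_multiplicity p P' hp,
      Ideal.IsDedekindDomain.ramificationIdx_eq_multiplicity p P hp]
    refine multiplicity_eq_of_emultiplicity_eq ?_
    have hpB : (p.map (algebraMap A B)).map β = p.map (algebraMap A B) := by
      conv_rhs => rw [← hα]
      change (p.map (algebraMap A B)).map (β : B →+* B) =
        (p.map (α : A →+* A)).map (algebraMap A B)
      rw [Ideal.map_map, Ideal.map_map]
      congr 1
      ext a
      exact (h a).symm
    let e : Ideal B ≃* Ideal B :=
      { Ideal.mapHom (β : B →+* B) with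
        invFun := Ideal.map (β.symm : B →+* B)
        left_inv := fun I ↦ Ideal.map_of_equiv β
        right_inv := fun I ↦ Ideal.map_of_equiv β.symm }
    rw [← emultiplicity_map_eq e (a := P), hP]
    congr 1
    exact hpB.symm
  · rw [Ideal.inertiaDeg_eq_of_isMaximal p P', Ideal.inertiaDeg_eq_of_isMaximal p P]
    symm
    refine Algebra.finrank_eq_of_equiv_equiv (Ideal.quotientEquiv p p α hα.symm)
      (Ideal.quotientEquiv P P' β hP) ?_
    ext a
    exact congrArg (Ideal.Quotient.mk P') (h a)

/-- Let a group `G` act on a finite extension `L` of the fraction field of a discrete valuation ring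
`A`, preserving `A`. If the degree of `L` is not divisible by `q`, then neither is, for some prime of
the integral closure, the index of the stabilizer times the degree of the residue field extension.
The factor `c` is carried along for use in inductions. -/
theorem exists_prime_not_dvd_index_mul_finrank {A K B L G : Type*} [CommRing A] [IsDomain A]
    [IsDiscreteValuationRing A] [Field K] [Field L] [Algebra A K] [IsFractionRing A K] [Algebra K L]
    [Algebra A L] [IsScalarTower A K L] [FiniteDimensional K L] [Algebra.IsSeparable K L]
    [CommRing B] [IsDomain B] [Algebra A B] [Algebra B L] [IsScalarTower A B L]
    [IsIntegralClosure B A L] [Group G] (α : G →* (A →+* A)) (β : G →* (B →+* B))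
    (h : ∀ g a, algebraMap A B (α g a) =
      β g (algebraMap A B a))
    (q c : ℕ) (hc : ¬ q ∣ c * Module.finrank K L) :
    ∃ (P : Ideal B) (_ : P.IsMaximal) (_ : P.LiesOver (maximalIdeal A))
      (G' : Subgroup G), P ≠ ⊥ ∧ (∀ g ∈ G', P ≤ P.comap (β g)) ∧
      ¬ q ∣ c * (G'.index * Module.finrank (A ⧸ maximalIdeal A) (B ⧸ P)) := by
  classical
  set p := maximalIdeal A
  have : FaithfulSMul A K := (faithfulSMul_iff_algebraMap_injective A K).mpr
    (IsFractionRing.injective A K)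
  have hAL : Function.Injective (algebraMap A L) := by
    rw [IsScalarTower.algebraMap_eq A K L]
    exact (algebraMap K L).injective.comp (IsFractionRing.injective A K)
  have : Module.IsTorsionFree A L := by
    have := (faithfulSMul_iff_algebraMap_injective A L).mpr hAL
    infer_instance
  have : Algebra.IsIntegral A B := IsIntegralClosure.isIntegral_algebra A L
  have : Module.IsTorsionFree A B := IsIntegralClosure.isTorsionFree A L
  have : IsDedekindDomain B := IsIntegralClosure.isDedekindDomain A K L B
  have : IsFractionRing B L := IsIntegralClosure.isFractionRing_of_finite_extension A K L B
  have : Module.Finite A B := IsIntegralClosure.finite A K L B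
  have hp0 : p ≠ ⊥ := IsDiscreteValuationRing.not_a_field A
  have hpB : p.map (algebraMap A B) ≠ ⊥ := Ideal.map_ne_bot_of_ne_bot hp0
  have hfin : (p.primesOver B).Finite := IsDedekindDomain.primesOver_finite p B
  have := hfin.fintype
  -- the action by automorphisms
  let αe (g : G) : A ≃+* A := .ofRingHom (α g) (α g⁻¹)
    (by rw [← RingHom.mul_def, ← map_mul]; simp; rfl)
    (by rw [← RingHom.mul_def, ← map_mul]; simp; rfl)
  let βe (g : G) : B ≃+* B := .ofRingHom (β g) (β g⁻¹)
    (by rw [← RingHom.mul_def, ← map_mul]; simp; rfl)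
    (by rw [← RingHom.mul_def, ← map_mul]; simp; rfl)
  have hα (g : G) : p.map (αe g) = p := map_ringEquiv_maximalIdeal (αe g)
  have hmax (P : p.primesOver B) : P.1.IsMaximal :=
    Ideal.isMaximal_of_isIntegral_of_isMaximal_comap P.1 (by
      have := P.2.2.over
      rw [Ideal.under_def] at this
      rw [← this]
      infer_instance)
  have hmem (g : G) (P : p.primesOver B) : P.1.map (βe g) ∈ p.primesOver B := by
    refine ⟨Ideal.map_isPrime_of_equiv (βe g), ⟨?_⟩⟩
    rw [Ideal.under_def, ← Ideal.comap_symm]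
    conv_lhs => rw [← hα g, P.2.2.over, ← Ideal.comap_symm]
    ext a
    simp only [Ideal.under_def, Ideal.mem_comap]
    have : algebraMap A B ((αe g).symm a) = (βe g).symm (algebraMap A B a) := h g⁻¹ a
    rw [this]
  let : MulAction G (p.primesOver B) :=
    { smul g P := ⟨P.1.map (βe g), hmem g P⟩
      one_smul P := Subtype.ext <| by
        change P.1.map (β 1) = P.1
        rw [map_one]
        exact Ideal.map_id _
      mul_smul g g' P := Subtype.ext <| by
        change P.1.map (β (g * g')) = (P.1.map (β g')).map (β g)
        rw [map_mul, Ideal.map_map]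
        rfl }
  have hsmul (g : G) (P : p.primesOver B) : (g • P).1 = P.1.map (βe g) := rfl
  obtain ⟨P, hP⟩ := exists_not_dvd_index_stabilizer_mul (G := G) (S := p.primesOver B)
    (fun P ↦ P.1.ramificationIdx A * P.1.inertiaDeg A)
    (fun g P ↦ by
      have := hmax P
      have := hmax (g • P)
      exact ramificationIdx_mul_inertiaDeg_comap (αe g) (βe g) (h g) p (hα g) hpB _ _ (hsmul g P))
    q c (by
      rwa [finsum_eq_sum_of_fintype, Ideal.sum_ramification_inertia_eq_finrank p B,
        ← IsFractionRing.finrank_eq A K B L])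
  have := hmax P
  refine ⟨P.1, inferInstance, P.2.2, MulAction.stabilizer G P,
    Ideal.ne_bot_of_mem_primesOver hp0 P.2, fun g hg ↦ ?_, fun hdvd ↦ hP ?_⟩
  · have : P.1.map (β g) = P.1 := congrArg Subtype.val hg
    exact Ideal.map_le_iff_le_comap.mp this.le
  · rw [← Ideal.inertiaDeg_eq_of_isMaximal p P.1] at hdvd
    refine hdvd.trans (mul_dvd_mul_left _ (mul_dvd_mul_left _ (dvd_mul_left _ _)))

/-! ### Specialization along a discrete valuation ring -/

/-- A morphism from `Spec L` to a proper scheme `Z` specializes to `Spec (B ⧸ P)`, for a nonzero prime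
`P` of a Dedekind domain `B` with fraction field `L`: by the valuative criterion it extends over the
discrete valuation ring `B_P`. The uniqueness of the extension makes the specialization compatible
with the endomorphisms that preserve `P`. -/
theorem exists_specialization {k B L : Type u} [Field k] [CommRing B] [IsDedekindDomain B]
    [Field L] [Algebra B L] [IsFractionRing B L] [Algebra k B] [Algebra k L] [IsScalarTower k B L]
    (P : Ideal B) [P.IsMaximal] (hP : P ≠ ⊥) {Z : Scheme.{u}} (s : Z ⟶ Spec (.of k)) [IsProper s]
    (φ : Spec (.of L) ⟶ Z) (hφ : φ ≫ s = Spec.map (CommRingCat.ofHom (algebraMap k L))) :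
    ∃ φ' : Spec (.of (B ⧸ P)) ⟶ Z,
      φ' ≫ s = Spec.map (CommRingCat.ofHom (algebraMap k (B ⧸ P))) ∧
      ∀ (β : B →ₐ[k] B) (hβ : P ≤ P.comap β) (τ : L →ₐ[k] L),
        (∀ b, algebraMap B L (β b) = τ (algebraMap B L b)) → ∀ ρ : Z ⟶ Z, ρ ≫ s = s →
        Spec.map (CommRingCat.ofHom τ.toRingHom) ≫ φ = φ ≫ ρ →
        Spec.map (CommRingCat.ofHom (Ideal.quotientMapₐ P β hβ).toRingHom) ≫ φ' = φ' ≫ ρ := by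
  let V := Localization.AtPrime P
  have : IsDiscreteValuationRing V :=
    IsLocalization.AtPrime.isDiscreteValuationRing_of_dedekind_domain B hP V
  have hle : P.primeCompl ≤ nonZeroDivisors B := P.primeCompl_le_nonZeroDivisors
  let : Algebra V L := IsLocalization.localizationAlgebraOfSubmonoidLe V L P.primeCompl
    (nonZeroDivisors B) hle
  have : IsScalarTower B V L := IsLocalization.localization_isScalarTower_of_submonoid_le V L _ _ hle
  have : IsFractionRing V L :=
    IsFractionRing.isFractionRing_of_isDomain_of_isLocalization P.primeCompl V L
  have hkV : (algebraMap V L).comp (algebraMap k V) = algebraMap k L := by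
    rw [IsScalarTower.algebraMap_eq k B V, ← RingHom.comp_assoc, ← IsScalarTower.algebraMap_eq B V L,
      ← IsScalarTower.algebraMap_eq]
  have hcomm : CommSq φ (Spec.map (CommRingCat.ofHom (algebraMap V L))) s
      (Spec.map (CommRingCat.ofHom (algebraMap k V))) := ⟨by
    rw [hφ, ← Spec.map_comp, ← CommRingCat.ofHom_comp, hkV]⟩
  have hval : ValuativeCriterion s := by
    have h : IsProper s := inferInstance
    rw [IsProper.eq_valuativeCriterion] at h
    exact h.1.1.1
  obtain ⟨ψ, hψ₁, hψ₂⟩ := (hval.existence { R := V, K := L, commSq := hcomm, .. }).exists_lift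
  dsimp only at ψ hψ₁ hψ₂
  -- the residue field of `V` is `B ⧸ P`
  have hunit (y : P.primeCompl) : IsUnit (Ideal.Quotient.mk P y) := by
    let := Ideal.Quotient.field P
    exact IsUnit.mk0 _ fun h ↦ y.2 (Ideal.Quotient.eq_zero_iff_mem.mp h)
  let r : V →+* B ⧸ P := IsLocalization.lift (M := P.primeCompl) hunit
  have hr : r.comp (algebraMap B V) = Ideal.Quotient.mk P := IsLocalization.lift_comp _
  refine ⟨Spec.map (CommRingCat.ofHom r) ≫ ψ, ?_, ?_⟩
  · rw [Category.assoc, hψ₂, ← Spec.map_comp, ← CommRingCat.ofHom_comp,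
      IsScalarTower.algebraMap_eq k B V, ← RingHom.comp_assoc, hr]
  · intro β hβ τ hτ ρ hρ heq
    have hPβ : P = P.comap (β : B →+* B) := Ideal.IsMaximal.eq_of_le inferInstance
      (Ideal.IsPrime.ne_top (Ideal.IsPrime.comap (β : B →+* B))) hβ
    let βV : V →+* V := Localization.localRingHom P P (β : B →+* B) hPβ
    have hβV (b : B) : βV (algebraMap B V b) = algebraMap B V (β b) :=
      Localization.localRingHom_to_map _ _ _ _ b
    have hβL : (algebraMap V L).comp βV = τ.toRingHom.comp (algebraMap V L) := by
      refine IsLocalization.ringHom_ext P.primeCompl (RingHom.ext fun b ↦ ?_)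
      have h1 : algebraMap V L (algebraMap B V (β b)) = τ (algebraMap V L (algebraMap B V b)) := by
        rw [← IsScalarTower.algebraMap_apply, ← IsScalarTower.algebraMap_apply, hτ]
      simpa [hβV] using h1
    have hβk : βV.comp (algebraMap k V) = algebraMap k V := by
      ext a
      rw [IsScalarTower.algebraMap_eq k B V]
      simp [hβV]
    have hβr : r.comp βV = (Ideal.quotientMapₐ P β hβ).toRingHom.comp r := by
      refine IsLocalization.ringHom_ext P.primeCompl (RingHom.ext fun b ↦ ?_)
      have h1 (b : B) : r (algebraMap B V b) = Ideal.Quotient.mk P b := RingHom.congr_fun hr b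
      simp only [RingHom.comp_apply, hβV, h1]
      rfl
    -- both sides extend the same morphism from the generic point of `Spec V`
    have key : Spec.map (CommRingCat.ofHom βV) ≫ ψ = ψ ≫ ρ := by
      have hc : CommSq (φ ≫ ρ) (Spec.map (CommRingCat.ofHom (algebraMap V L))) s
          (Spec.map (CommRingCat.ofHom (algebraMap k V))) := ⟨by
        rw [Category.assoc, hρ, hcomm.w]⟩
      have hu : Subsingleton hc.LiftStruct :=
        hval.uniqueness { R := V, K := L, commSq := hc, .. }
      let l₁ : hc.LiftStruct := ⟨Spec.map (CommRingCat.ofHom βV) ≫ ψ, by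
        rw [← heq, ← hψ₁, ← Category.assoc, ← Category.assoc, ← Spec.map_comp, ← Spec.map_comp,
          ← CommRingCat.ofHom_comp, ← CommRingCat.ofHom_comp, hβL], by
        rw [Category.assoc, hψ₂, ← Spec.map_comp, ← CommRingCat.ofHom_comp, hβk]⟩
      let l₂ : hc.LiftStruct := ⟨ψ ≫ ρ, by rw [← Category.assoc, hψ₁], by
        rw [Category.assoc, hρ, hψ₂]⟩
      exact congrArg CommSq.LiftStruct.l (Subsingleton.elim l₁ l₂)
    rw [← Category.assoc, ← Spec.map_comp, ← CommRingCat.ofHom_comp, ← hβr, CommRingCat.ofHom_comp,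
      Spec.map_comp, Category.assoc, key, Category.assoc]

/-- The inductive step: a discrete valuation ring `A` with an action of `G` which extends to a finite
extension `L` of its fraction field allows one to replace `L` by an extension `L'` of the residue
field of `A`, namely the residue field of a prime `P` of the integral closure of `A` in `L`, and `G`
by the stabilizer of `P`. -/
theorem exists_residue_extension {k A K L : Type u} [Field k] [CharZero k] [CommRing A] [IsDomain A]
    [IsDiscreteValuationRing A] [Field K] [Field L] [Algebra A K] [IsFractionRing A K] [Algebra K L]
    [Algebra A L] [IsScalarTower A K L] [FiniteDimensional K L]
    [Algebra k A] [Algebra k L] [IsScalarTower k A L] {G : Type v} [Group G]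
    (τ : G →* (L →ₐ[k] L)) (α : G → A →+* A)
    (h : ∀ g a, algebraMap A L (α g a) = τ g (algebraMap A L a))
    (q c : ℕ) (hc : ¬ q ∣ c * Module.finrank K L) :
    ∃ (L' : Type u) (_ : Field L') (_ : Algebra k L') (_ : Algebra (A ⧸ maximalIdeal A) L')
      (_ : IsScalarTower k (A ⧸ maximalIdeal A) L') (G' : Subgroup G)
      (τ' : G' →* (L' →ₐ[k] L')),
      (∀ (g : G') a, algebraMap (A ⧸ maximalIdeal A) L' (Ideal.Quotient.mk _ (α g a)) =
        τ' g (algebraMap (A ⧸ maximalIdeal A) L' (Ideal.Quotient.mk _ a))) ∧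
      ¬ q ∣ c * (G'.index * Module.finrank (A ⧸ maximalIdeal A) L') ∧
      ∀ (Z : Scheme.{u}) (s : Z ⟶ Spec (.of k)) [IsProper s] (ρ : G → (Z ⟶ Z))
        (_ : ∀ g, ρ g ≫ s = s) (φ : Spec (.of L) ⟶ Z)
        (_ : φ ≫ s = Spec.map (CommRingCat.ofHom (algebraMap k L)))
        (_ : ∀ g, Spec.map (CommRingCat.ofHom (τ g).toRingHom) ≫ φ = φ ≫ ρ g),
        ∃ φ' : Spec (.of L') ⟶ Z,
          φ' ≫ s = Spec.map (CommRingCat.ofHom (algebraMap k L')) ∧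
          ∀ g : G', Spec.map (CommRingCat.ofHom (τ' g).toRingHom) ≫ φ' = φ' ≫ ρ g := by
  have hAL : Function.Injective (algebraMap A L) := by
    rw [IsScalarTower.algebraMap_eq A K L]
    exact (algebraMap K L).injective.comp (IsFractionRing.injective A K)
  have : CharZero A := by
    have : Nontrivial A := inferInstance
    exact charZero_of_injective_algebraMap (algebraMap k A).injective
  have : CharZero K := charZero_of_injective_algebraMap (IsFractionRing.injective A K)
  let B := integralClosure A L
  have hτB (g : G) (x : B) : τ g x ∈ B :=
    IsIntegral.map_of_comp_eq (α g) (τ g).toRingHom (RingHom.ext (h g)) x.2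
  let β : G →* (B →ₐ[k] B) :=
    { toFun g :=
        { toFun x := ⟨τ g x, hτB g x⟩
          map_one' := Subtype.ext (map_one (τ g))
          map_mul' x y := Subtype.ext (map_mul (τ g) (x : L) y)
          map_zero' := Subtype.ext (map_zero (τ g))
          map_add' x y := Subtype.ext (map_add (τ g) (x : L) y)
          commutes' a := Subtype.ext <| by
            have h1 : ((algebraMap k B a : B) : L) = algebraMap k L a := rfl
            change τ g ((algebraMap k B a : B) : L) = ((algebraMap k B a : B) : L)
            rw [h1, AlgHom.commutes] }
      map_one' := by
        ext x
        change τ 1 (x : L) = x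
        rw [map_one]
        rfl
      map_mul' g g' := by
        ext x
        change τ (g * g') (x : L) = τ g (τ g' (x : L))
        rw [map_mul]
        rfl }
  have hβ (g : G) (x : B) : ((β g x : B) : L) = τ g x := rfl
  let αM : G →* (A →+* A) :=
    { toFun := α
      map_one' := RingHom.ext fun a ↦ hAL <| by
        rw [h, map_one]
        rfl
      map_mul' g g' := RingHom.ext fun a ↦ hAL <| by
        rw [h, map_mul]
        change τ g (τ g' _) = algebraMap A L (α g (α g' a))
        rw [h, h] }
  let βM : G →* (B →+* B) :=
    { toFun g := (β g).toRingHom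
      map_one' := by rw [map_one]; rfl
      map_mul' g g' := by rw [map_mul]; rfl }
  have : IsDedekindDomain B := integralClosure.isDedekindDomain A K L
  have : IsFractionRing B L := IsIntegralClosure.isFractionRing_of_finite_extension A K L B
  have hαβ (g : G) (a : A) : algebraMap A B (α g a) = β g (algebraMap A B a) := Subtype.ext (h g a)
  obtain ⟨P, hPm, hPp, G', hP0, hPG, hdvd⟩ := exists_prime_not_dvd_index_mul_finrank (K := K)
    (L := L) αM βM hαβ q c hc
  have : IsScalarTower k B L := .of_algebraMap_eq fun a ↦ rfl
  have : IsScalarTower k A B := .of_algebraMap_eq fun a ↦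
    Subtype.ext (IsScalarTower.algebraMap_apply k A L a)
  let τ' : G' →* ((B ⧸ P) →ₐ[k] (B ⧸ P)) :=
    { toFun g := Ideal.quotientMapₐ P (β g) (hPG g g.2)
      map_one' := by
        refine AlgHom.ext fun x ↦ ?_
        obtain ⟨x, rfl⟩ := Ideal.Quotient.mk_surjective x
        change Ideal.Quotient.mk P (β 1 x) = _
        rw [map_one]
        rfl
      map_mul' g g' := by
        refine AlgHom.ext fun x ↦ ?_
        obtain ⟨x, rfl⟩ := Ideal.Quotient.mk_surjective x
        change Ideal.Quotient.mk P (β (g * g') x) = _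
        rw [map_mul]
        rfl }
  refine ⟨B ⧸ P, Ideal.Quotient.field P, inferInstance, inferInstance, ?_, G', τ', ?_, hdvd, ?_⟩
  · refine .of_algebraMap_eq fun a ↦ ?_
    change Ideal.Quotient.mk P (algebraMap k B a) =
      Ideal.Quotient.mk P (algebraMap A B (algebraMap k A a))
    rw [← IsScalarTower.algebraMap_apply]
  · intro g a
    change Ideal.Quotient.mk P (algebraMap A B (α g a)) =
      Ideal.Quotient.mk P (β g (algebraMap A B a))
    rw [hαβ]
  · intro Z s _ ρ hρ φ hφ heq
    obtain ⟨φ', hφ', h'⟩ := exists_specialization P hP0 s φ hφ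
    exact ⟨φ', hφ', fun g ↦ h' (β g) (hPG g g.2) (τ g) (fun b ↦ rfl) (ρ g) (hρ g) (heq g)⟩

/-! ### Fixed points from a fixed smooth point -/

/-- The case of dimension zero: then `R`, its fraction field and `L` are all equal to `k`. -/
theorem algebraMap_surjective_of_maximalIdeal_eq_bot {k R K L : Type u} [Field k] [IsAlgClosed k]
    [CommRing R] [Algebra k R] [IsLocalRing R] (ε : R →ₐ[k] k) (h : maximalIdeal R = ⊥)
    [Field K] [Field L] [Algebra R K] [IsFractionRing R K] [Algebra K L] [Algebra R L]
    [IsScalarTower R K L] [FiniteDimensional K L] [Algebra k L] [IsScalarTower k R L] :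
    Function.Surjective (algebraMap k L) ∧ Function.Surjective (algebraMap K L) := by
  have hkR : Function.Surjective (algebraMap k R) := fun x ↦ ⟨ε x, by
    have h1 : x - algebraMap k R (ε x) ∈ maximalIdeal R :=
      (mem_maximalIdeal_iff_eq_zero ε).mpr (by simp)
    rw [h, Ideal.mem_bot, sub_eq_zero] at h1
    exact h1.symm⟩
  have hRK : Function.Surjective (algebraMap R K) := by
    let := (isField_iff_maximalIdeal_eq.mpr h).toField
    exact (IsFractionRing.surjective_iff_isField (R := R)).mpr (isField_iff_maximalIdeal_eq.mpr h)
  have e : k ≃+* K := RingEquiv.ofBijective ((algebraMap R K).comp (algebraMap k R))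
    ⟨RingHom.injective _, hRK.comp hkR⟩
  have : IsAlgClosed K := IsAlgClosed.of_ringEquiv k K e
  have hKL : Function.Surjective (algebraMap K L) :=
    (IsAlgClosed.algebraMap_bijective_of_isIntegral).2
  refine ⟨?_, hKL⟩
  rw [IsScalarTower.algebraMap_eq k R L, IsScalarTower.algebraMap_eq R K L]
  exact (hKL.comp hRK).comp hkR

/-- The algebraic form of going up, by induction on the number `n` of generators of the maximal ideal
of `R`. Here `R` is a local ring at a fixed smooth `k`-point, `K` its fraction field, and `L` a
finite extension of `K` to which the action of `G` extends. The factor `c` accounts for the index of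
`G` in the group considered before the passage to stabilizers. Infinite extensions are excluded by
the divisibility hypothesis, since then `Module.finrank K L = 0`. -/
theorem exists_subgroup_fixing_points {k : Type u} [Field k] [IsAlgClosed k] [CharZero k]
    (q n : ℕ) : ∀ (G : Type v) [CommGroup G] [Finite G] (R K L : Type u) [CommRing R] [Algebra k R]
    [IsLocalRing R] [IsNoetherianRing R] (_ : R →ₐ[k] k) (_ : TangentVectorsLift k R)
    (_ : ∃ f : Fin n → R, maximalIdeal R = Ideal.span (Set.range f))
    [Field K] [Field L] [Algebra R K] [IsFractionRing R K] [Algebra K L] [Algebra R L]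
    [IsScalarTower R K L] [Algebra k L] [IsScalarTower k R L]
    (τ : G →* (L →ₐ[k] L)) (σ : G → R →ₐ[k] R)
    (_ : ∀ g r, algebraMap R L (σ g r) = τ g (algebraMap R L r))
    (c : ℕ) (_ : ¬ q ∣ c * Module.finrank K L),
    ∃ G' : Subgroup G, ¬ q ∣ c * G'.index ∧
      ∀ (Z : Scheme.{u}) (s : Z ⟶ Spec (.of k)) [IsProper s] (ρ : G → (Z ⟶ Z))
        (_ : ∀ g, ρ g ≫ s = s) (φ : Spec (.of L) ⟶ Z)
        (_ : φ ≫ s = Spec.map (CommRingCat.ofHom (algebraMap k L)))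
        (_ : ∀ g, Spec.map (CommRingCat.ofHom (τ g).toRingHom) ≫ φ = φ ≫ ρ g),
        ∃ z : Spec (.of k) ⟶ Z, z ≫ s = 𝟙 _ ∧ ∀ g ∈ G', z ≫ ρ g = z := by
  induction n with
  | zero => ?_
  | succ n ih => ?_
  all_goals
    intro G _ _ R K L _ _ _ _ ε hR hf _ _ _ _ _ _ _ _ _ τ σ hσ c hc
    have : FiniteDimensional K L := Module.finite_of_finrank_pos (Nat.pos_of_ne_zero fun h ↦ by
      simp [h] at hc)
    have hbot : maximalIdeal R = ⊥ → ∃ G' : Subgroup G, ¬ q ∣ c * G'.index ∧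
        ∀ (Z : Scheme.{u}) (s : Z ⟶ Spec (.of k)) [IsProper s] (ρ : G → (Z ⟶ Z))
          (_ : ∀ g, ρ g ≫ s = s) (φ : Spec (.of L) ⟶ Z)
          (_ : φ ≫ s = Spec.map (CommRingCat.ofHom (algebraMap k L)))
          (_ : ∀ g, Spec.map (CommRingCat.ofHom (τ g).toRingHom) ≫ φ = φ ≫ ρ g),
          ∃ z : Spec (.of k) ⟶ Z, z ≫ s = 𝟙 _ ∧ ∀ g ∈ G', z ≫ ρ g = z := by
      intro h0
      obtain ⟨hkL, hKL⟩ := algebraMap_surjective_of_maximalIdeal_eq_bot (K := K) (L := L) ε h0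
      have h1 : Module.finrank K L = 1 := by
        refine finrank_eq_one (1 : L) one_ne_zero fun w ↦ ?_
        obtain ⟨a, rfl⟩ := hKL w
        exact ⟨a, by rw [Algebra.smul_def, mul_one]⟩
      refine ⟨⊤, by simpa [h1] using hc, fun Z s _ ρ hρ φ hφ heq ↦ ?_⟩
      let e : k ≃+* L := RingEquiv.ofBijective (algebraMap k L) ⟨(algebraMap k L).injective, hkL⟩
      have he : (e.symm : L →+* k).comp (algebraMap k L) = RingHom.id k :=
        RingHom.ext fun a ↦ e.symm_apply_apply a
      refine ⟨Spec.map (CommRingCat.ofHom (e.symm : L →+* k)) ≫ φ, ?_, fun g _ ↦ ?_⟩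
      · rw [Category.assoc, hφ, ← Spec.map_comp, ← CommRingCat.ofHom_comp, he]
        exact Spec.map_id _
      · have hτ : (τ g).toRingHom = RingHom.id L := by
          ext x
          obtain ⟨a, rfl⟩ := hkL x
          exact (τ g).commutes a
        have hg := heq g
        rw [hτ, CommRingCat.ofHom_id, Spec.map_id, Category.id_comp] at hg
        rw [Category.assoc, ← hg]
  · obtain ⟨f, hf⟩ := hf
    exact hbot (by simpa using hf)
  by_cases h0 : maximalIdeal R = ⊥
  · exact hbot h0
  -- the action of `G` on `R`
  have hRL : Function.Injective (algebraMap R L) := by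
    rw [IsScalarTower.algebraMap_eq R K L]
    exact (algebraMap K L).injective.comp (IsFractionRing.injective R K)
  have hσ1 (x : R) : σ 1 x = x := hRL <| by rw [hσ, map_one]; rfl
  have hσm (g g' : G) (x : R) : σ (g * g') x = σ g (σ g' x) := hRL <| by
    rw [hσ, hσ, hσ, map_mul]; rfl
  have hσi (g : G) (x : R) : σ g⁻¹ (σ g x) = x := by rw [← hσm, inv_mul_cancel, hσ1]
  have hσmax (g : G) (x : R) (hx : x ∈ maximalIdeal R) : σ g x ∈ maximalIdeal R := fun hu ↦
    hx (by simpa [hσi] using hu.map (σ g⁻¹))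
  -- a `G`-stable smooth hypersurface germ
  obtain ⟨t, ht, ht', hteig⟩ := exists_eigenvector_notMem (fun g ↦ (σ g).toLinearMap) hσm hσ1
    (S := (maximalIdeal R).restrictScalars k) (W := (maximalIdeal R ^ 2).restrictScalars k)
    hσmax (fun h ↦ not_maximalIdeal_le_sq h0 fun x hx ↦ by
      simpa only [Submodule.restrictScalars_mem] using @h x hx)
  have ht : t ∈ maximalIdeal R := ht
  have ht' : t ∉ maximalIdeal R ^ 2 := ht'
  have := isLocalRing_quotient_span_singleton ht
  have hR' := hR.quotient ht ht'
  have hf' := exists_span_maximalIdeal_quotient ht ht' hf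
  let p : Ideal R := Ideal.span {t}
  have hp : p.IsPrime := (Ideal.Quotient.isDomain_iff_prime _).mp (hR'.isDomain n _ hf')
  have htp : t ∈ p := Ideal.mem_span_singleton_self t
  have hσp (g : G) : p ≤ p.comap (σ g : R →+* R) := by
    rw [Ideal.span_singleton_le_iff_mem, Ideal.mem_comap]
    obtain ⟨a, ha⟩ := hteig g
    have : σ g t = a • t := ha
    change σ g t ∈ p
    rw [this, Algebra.smul_def]
    exact Ideal.mul_mem_left _ _ htp
  have hσp' (g : G) : p = p.comap (σ g : R →+* R) := le_antisymm (hσp g) fun x hx ↦ by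
    have := hσp g⁻¹ hx
    rw [Ideal.mem_comap] at this
    simpa [hσi] using this
  -- its local ring at the generic point
  have : IsDomain R := (IsFractionRing.injective R K).isDomain (algebraMap R K)
  have ht0 : t ≠ 0 := fun h ↦ ht' (h ▸ zero_mem _)
  let A := Localization.AtPrime p
  have hle : p.primeCompl ≤ nonZeroDivisors R := p.primeCompl_le_nonZeroDivisors
  have hmA : maximalIdeal A = Ideal.span {algebraMap R A t} := by
    rw [← Localization.AtPrime.map_eq_maximalIdeal, Ideal.map_span, Set.image_singleton]
  have : IsDomain A := IsLocalization.isDomain_localization hle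
  have hRA : Function.Injective (algebraMap R A) := IsLocalization.injective A hle
  have hA0 : ¬ IsField A := by
    rw [isField_iff_maximalIdeal_eq, hmA, Ideal.span_singleton_eq_bot, map_eq_zero_iff _ hRA]
    exact ht0
  have : IsNoetherianRing A := IsLocalization.isNoetherianRing p.primeCompl A inferInstance
  have : IsDiscreteValuationRing A := by
    have h := (IsDiscreteValuationRing.TFAE A hA0).out 0 4
    exact h.mpr ⟨_, hmA⟩
  let : Algebra A K := IsLocalization.localizationAlgebraOfSubmonoidLe A K p.primeCompl
    (nonZeroDivisors R) hle
  have : IsScalarTower R A K := IsLocalization.localization_isScalarTower_of_submonoid_le A K _ _ hle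
  have : IsFractionRing A K :=
    IsFractionRing.isFractionRing_of_isDomain_of_isLocalization p.primeCompl A K
  let : Algebra A L := ((algebraMap K L).comp (algebraMap A K)).toAlgebra
  have : IsScalarTower A K L := .of_algebraMap_eq' rfl
  have : IsScalarTower R A L := .of_algebraMap_eq fun r ↦ by
    rw [IsScalarTower.algebraMap_apply A K L, ← IsScalarTower.algebraMap_apply R A K,
      ← IsScalarTower.algebraMap_apply]
  have : IsScalarTower k A L := .of_algebraMap_eq fun a ↦ by
    rw [IsScalarTower.algebraMap_apply k R A, ← IsScalarTower.algebraMap_apply R A L,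
      ← IsScalarTower.algebraMap_apply]
  let α (g : G) : A →+* A := Localization.localRingHom p p (σ g : R →+* R) (hσp' g)
  have hα (g : G) (r : R) : α g (algebraMap R A r) = algebraMap R A (σ g r) :=
    Localization.localRingHom_to_map _ _ _ _ r
  have hαL (g : G) : (algebraMap A L).comp (α g) = (τ g).toRingHom.comp (algebraMap A L) := by
    refine IsLocalization.ringHom_ext p.primeCompl (RingHom.ext fun r ↦ ?_)
    have h1 : algebraMap A L (algebraMap R A (σ g r)) =
        τ g (algebraMap A L (algebraMap R A r)) := by
      rw [← IsScalarTower.algebraMap_apply, ← IsScalarTower.algebraMap_apply, hσ]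
    simpa [hα] using h1
  obtain ⟨L', _, _, _, _, G₁, τ', hτ', hdvd, hZ⟩ := exists_residue_extension τ α
    (fun g ↦ RingHom.congr_fun (hαL g)) q c hc
  -- the function field of the hypersurface
  let K' := A ⧸ maximalIdeal A
  let : Field K' := Ideal.Quotient.field _
  let π : (R ⧸ p) →+* K' := Ideal.quotientMap (maximalIdeal A) (algebraMap R A)
    (Localization.AtPrime.under_maximalIdeal (I := p)).ge
  let : Algebra (R ⧸ p) K' := π.toAlgebra
  let : Algebra (R ⧸ p) L' := ((algebraMap K' L').comp π).toAlgebra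
  have : IsScalarTower (R ⧸ p) K' L' := .of_algebraMap_eq' rfl
  have hπ (r : R) : algebraMap (R ⧸ p) K' (Ideal.Quotient.mk p r) =
      Ideal.Quotient.mk _ (algebraMap R A r) := rfl
  have hπL (r : R) : algebraMap (R ⧸ p) L' (Ideal.Quotient.mk p r) =
      algebraMap K' L' (Ideal.Quotient.mk _ (algebraMap R A r)) := rfl
  have hpi : Function.Injective (algebraMap (R ⧸ p) K') := Ideal.quotientMap_injective'
    (Localization.AtPrime.under_maximalIdeal (I := p)).le
  have : FaithfulSMul (R ⧸ p) K' := (faithfulSMul_iff_algebraMap_injective _ _).mpr hpi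
  have : IsFractionRing (R ⧸ p) K' := IsFractionRing.of_field _ _ fun z ↦ by
    obtain ⟨z, rfl⟩ := Ideal.Quotient.mk_surjective z
    obtain ⟨x, y, rfl⟩ := IsLocalization.exists_mk'_eq p.primeCompl z
    refine ⟨Ideal.Quotient.mk p x, Ideal.Quotient.mk p y, ?_⟩
    have hy : algebraMap (R ⧸ p) K' (Ideal.Quotient.mk p y) ≠ 0 := by
      rw [Ne, map_eq_zero_iff _ hpi, Ideal.Quotient.eq_zero_iff_mem]
      exact y.2
    rw [eq_div_iff hy, hπ, hπ, ← map_mul, IsLocalization.mk'_spec]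
  have : IsScalarTower k (R ⧸ p) L' := .of_algebraMap_eq fun a ↦ by
    rw [IsScalarTower.algebraMap_apply k K' L']
    change _ = algebraMap K' L' (Ideal.Quotient.mk _ (algebraMap R A (algebraMap k R a)))
    rw [← IsScalarTower.algebraMap_apply k R A]
    rfl
  have hε : ∀ x ∈ p, ε x = 0 := fun x hx ↦ (mem_maximalIdeal_iff_eq_zero ε).mp
    ((Ideal.span_singleton_le_iff_mem _).mpr ht hx)
  obtain ⟨G₂, hG₂, hZ₂⟩ := ih G₁ (R ⧸ p) K' L' (Ideal.Quotient.liftₐ p ε hε) hR' hf' τ'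
    (fun g ↦ Ideal.quotientMapₐ p (σ g) (hσp g)) (fun g r ↦ by
      obtain ⟨r, rfl⟩ := Ideal.Quotient.mk_surjective r
      change algebraMap (R ⧸ p) L' (Ideal.Quotient.mk p (σ g r)) = _
      rw [hπL, hπL, ← hα, hτ']) (c * G₁.index) (by rwa [mul_assoc])
  refine ⟨G₂.map G₁.subtype, ?_, fun Z s _ ρ hρ φ hφ heq ↦ ?_⟩
  · rwa [Subgroup.index_map_subtype, mul_comm G₂.index, ← mul_assoc]
  · obtain ⟨φ', hφ', heq'⟩ := hZ Z s ρ hρ φ hφ heq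
    obtain ⟨z, hz, hfix⟩ := hZ₂ Z s (fun g ↦ ρ g) (fun g ↦ hρ g) φ' hφ' heq'
    refine ⟨z, hz, fun g hg ↦ ?_⟩
    obtain ⟨g, hg, rfl⟩ := hg
    exact hfix g hg

/-! ### Generic points -/

section GenericPoints

variable {α : Type*} [TopologicalSpace α]

/-- The generic points of irreducible components are the points without proper generizations. -/
theorem mem_genericPoints_iff [QuasiSober α] {x : α} :
    x ∈ genericPoints α ↔ ∀ y, y ⤳ x → x ⤳ y := by
  constructor
  · intro hx y hy
    have h : closure {y} ≤ closure {x} := hx.2 isIrreducible_singleton.closure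
      (closure_minimal (Set.singleton_subset_iff.mpr hy.mem_closure) isClosed_closure)
    exact specializes_iff_mem_closure.mpr (h (subset_closure rfl))
  · intro h
    refine ⟨isIrreducible_singleton.closure, fun s hs hxs ↦ ?_⟩
    obtain ⟨y, hy⟩ := QuasiSober.sober hs.closure isClosed_closure
    have hyx : y ⤳ x := hy.specializes (subset_closure (hxs (subset_closure rfl)))
    have hxy := h y hyx
    refine subset_closure.trans ?_
    rw [← hy.def]
    exact closure_minimal (Set.singleton_subset_iff.mpr hxy.mem_closure) isClosed_closure

theorem mem_of_mem_genericPoints [TopologicalSpace.NoetherianSpace α] {x : α}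
    (hx : x ∈ genericPoints α) {W : Set α} (hW : IsOpen W) (hd : Dense W) : x ∈ W := by
  obtain ⟨U, hU, hne, hUx⟩ :=
    TopologicalSpace.NoetherianSpace.exists_isOpen_nonempty_subset_irreducibleComponent _ hx
  obtain ⟨y, hyU, hyW⟩ := hd.inter_open_nonempty U hU hne
  exact (specializes_iff_mem_closure.mpr (hUx hyU)).mem_open hW hyW

theorem homeomorph_mem_genericPoints [QuasiSober α] (e : α ≃ₜ α) {x : α}
    (hx : x ∈ genericPoints α) : e x ∈ genericPoints α := by
  rw [mem_genericPoints_iff] at hx ⊢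
  intro y hy
  have h1 := hx (e.symm y) (by simpa using hy.map e.symm.continuous)
  simpa using h1.map e.continuous

theorem mem_genericPoints_iff_of_isOpenEmbedding {β : Type*} [TopologicalSpace β] [QuasiSober α]
    [QuasiSober β] {i : β → α} (hi : Topology.IsOpenEmbedding i) {x : β} :
    x ∈ genericPoints β ↔ i x ∈ genericPoints α := by
  rw [mem_genericPoints_iff, mem_genericPoints_iff]
  constructor
  · intro h y hy
    obtain ⟨y, rfl⟩ := hy.mem_open hi.isOpen_range ⟨x, rfl⟩
    exact hi.isInducing.specializes_iff.mpr (h y (hi.isInducing.specializes_iff.mp hy))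
  · intro h y hy
    exact hi.isInducing.specializes_iff.mp (h _ (hi.isInducing.specializes_iff.mpr hy))

end GenericPoints

/-! ### Morphisms from spectra of local rings -/

section Stalks

variable {X Y Z : Scheme.{u}}

/-- The stalk map of a morphism, with a free choice of name `y` for the image point. -/
theorem exists_stalk_hom (a : X ⟶ Y) {x : X} {y : Y} (h : a x = y) :
    ∃ θ : Y.presheaf.stalk y ⟶ X.presheaf.stalk x,
      Spec.map θ ≫ Y.fromSpecStalk y = X.fromSpecStalk x ≫ a ∧ (IsOpenImmersion a → IsIso θ) := by
  subst h
  exact ⟨a.stalkMap x, Scheme.SpecMap_stalkMap_fromSpecStalk a, fun _ ↦ inferInstance⟩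

/-- The canonical morphism from the spectrum of a local ring to the scheme is a monomorphism, so that
homomorphisms out of the local ring may be compared as morphisms to the scheme. -/
theorem stalk_hom_ext {S : CommRingCat.{u}} {y : Y} {θ θ' : Y.presheaf.stalk y ⟶ S}
    (h : Spec.map θ ≫ Y.fromSpecStalk y = Spec.map θ' ≫ Y.fromSpecStalk y) : θ = θ' :=
  Spec.map_injective ((cancel_mono _).mp h)

theorem fromSpecStalkOfMem_eq (U : X.Opens) (ξ : U.toScheme) (h : U.ι ξ ∈ U) :
    U.fromSpecStalkOfMem (U.ι ξ) h =
      Spec.map (inv (U.ι.stalkMap ξ)) ≫ U.toScheme.fromSpecStalk ξ := by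
  rw [← cancel_mono U.ι, Scheme.Opens.fromSpecStalkOfMem_ι, Category.assoc,
    ← Scheme.SpecMap_stalkMap_fromSpecStalk, ← Category.assoc, ← Spec.map_comp,
    IsIso.hom_inv_id, Spec.map_id, Category.id_comp]

theorem isField_stalk_of_mem_genericPoints [IsReduced X] {x : X} (hx : x ∈ genericPoints X) :
    IsField (X.presheaf.stalk x) := by
  -- the spectrum of the local ring is a single point
  have hsub : ∀ a : Spec (X.presheaf.stalk x), a = closedPoint (X.presheaf.stalk x) := by
    intro a
    refine (X.fromSpecStalk x).isEmbedding.injective ?_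
    have h1 : X.fromSpecStalk x a ⤳ x := by
      have := (specializes_closedPoint a).map (X.fromSpecStalk x).continuous
      rwa [Scheme.fromSpecStalk_closedPoint] at this
    rw [Scheme.fromSpecStalk_closedPoint]
    exact (h1.antisymm (mem_genericPoints_iff.mp hx _ h1)).eq
  rw [isField_iff_maximalIdeal_eq]
  have h2 : nilradical (X.presheaf.stalk x) = maximalIdeal (X.presheaf.stalk x) := by
    rw [nilradical_eq_sInf]
    refine le_antisymm (sInf_le (inferInstance : (maximalIdeal _).IsPrime)) (le_sInf fun p hp ↦ ?_)
    have := congrArg PrimeSpectrum.asIdeal (hsub ⟨p, hp⟩)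
    exact this.ge
  rw [← h2, nilradical_eq_zero]
  rfl

/-- The degree `[B : A]` of a homomorphism `ι : A ⟶ B`, used for extensions of function fields. It is
`0` when the extension is infinite. -/
def degreeOf {A B : CommRingCat.{u}} (ι : A ⟶ B) : ℕ :=
  letI := ι.hom.toAlgebra
  Module.finrank A B

theorem degreeOf_eq_of_isIso {A A' B B' : CommRingCat.{u}} (ι : A ⟶ B) (ι' : A' ⟶ B')
    (θ : A ⟶ A') (ζ : B ⟶ B') [IsIso θ] [IsIso ζ] (h : ι ≫ ζ = θ ≫ ι') :
    degreeOf ι = degreeOf ι' := by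
  let := ι.hom.toAlgebra
  let := ι'.hom.toAlgebra
  refine Algebra.finrank_eq_of_equiv_equiv (asIso θ).commRingCatIsoToRingEquiv
    (asIso ζ).commRingCatIsoToRingEquiv ?_
  exact congrArg CommRingCat.Hom.hom h.symm

theorem formallySmooth_preimage_fromSpecStalk_Spec (R : CommRingCat.{u}) (x : Spec R) :
    (Spec.preimage ((Spec R).fromSpecStalk x)).hom.FormallySmooth := by
  let θ : R ⟶ (Spec R).presheaf.stalk x := StructureSheaf.toStalk R x
  have h : Spec.preimage ((Spec R).fromSpecStalk x) = θ :=
    Spec.map_injective ((Spec.map_preimage _).trans (Spec.fromSpecStalk_eq' R x))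
  rw [h]
  let := θ.hom.toAlgebra
  let y : PrimeSpectrum R := x
  have : IsLocalization.AtPrime ((Spec R).presheaf.stalk x) y.asIdeal :=
    StructureSheaf.IsLocalization.to_stalk R y
  exact Algebra.FormallySmooth.of_isLocalization y.asIdeal.primeCompl

theorem formallySmooth_preimage_fromSpecStalk {R : CommRingCat.{u}} (s : X ⟶ Spec R) [Smooth s]
    (x : X) : (Spec.preimage (X.fromSpecStalk x ≫ s)).hom.FormallySmooth := by
  have h1 : (s.stalkMap x).hom.FormallySmooth := by
    rw [← Scheme.Hom.mem_smoothLocus, Scheme.Hom.smoothLocus_eq_top]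
    trivial
  have h2 : Spec.preimage (X.fromSpecStalk x ≫ s) =
      Spec.preimage ((Spec R).fromSpecStalk (s x)) ≫ s.stalkMap x := by
    refine Spec.map_injective ?_
    rw [Spec.map_preimage, Spec.map_comp, Spec.map_preimage,
      Scheme.SpecMap_stalkMap_fromSpecStalk s]
  rw [h2]
  exact (formallySmooth_preimage_fromSpecStalk_Spec R (s x)).comp h1

/-- The local ring at a point where `s` is smooth is formally smooth over the base ring. -/
theorem formallySmooth_preimage_fromSpecStalk_of_mem {R : CommRingCat.{u}} (s : X ⟶ Spec R) (x : X)
    (U : X.Opens) (hx : x ∈ U) [Smooth (U.ι ≫ s)] :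
    (Spec.preimage (X.fromSpecStalk x ≫ s)).hom.FormallySmooth := by
  obtain ⟨x, rfl⟩ : ∃ x' : U.toScheme, U.ι x' = x := ⟨⟨x, hx⟩, rfl⟩
  have h2 : Spec.preimage (X.fromSpecStalk (U.ι x) ≫ s) =
      Spec.preimage (U.toScheme.fromSpecStalk x ≫ U.ι ≫ s) ≫ inv (U.ι.stalkMap x) := by
    rw [IsIso.eq_comp_inv]
    refine Spec.map_injective ?_
    rw [Spec.map_preimage, Spec.map_comp, Spec.map_preimage, ← Category.assoc,
      Scheme.SpecMap_stalkMap_fromSpecStalk, Category.assoc]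
  rw [h2]
  exact (formallySmooth_preimage_fromSpecStalk (U.ι ≫ s) x).comp
    (.of_bijective (ConcreteCategory.bijective_of_isIso (inv (U.ι.stalkMap x))))

end Stalks

/-! ### Rational maps at generic points -/

section GenericMaps

variable {X Y : Scheme.{u}} [TopologicalSpace.NoetherianSpace X]

/-- The restriction of a partial map to the local ring of a generic point `x`: on a Noetherian
scheme `x` lies in every dense open subset. -/
def genericMap (φ : X.PartialMap Y) {x : X} (hx : x ∈ genericPoints X) :
    Spec (X.presheaf.stalk x) ⟶ Y :=
  φ.fromSpecStalkOfMem (mem_of_mem_genericPoints hx φ.domain.2 φ.dense_domain)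

/-- The restriction to a generic point depends only on the rational map. -/
theorem genericMap_eq_of_equiv {φ ψ : X.PartialMap Y} (h : φ.equiv ψ) {x : X}
    (hx : x ∈ genericPoints X) : genericMap φ hx = genericMap ψ hx := by
  obtain ⟨W, hW, hWl, hWr, e⟩ := h
  have hxW : x ∈ W := mem_of_mem_genericPoints hx W.2 hW
  rw [genericMap, genericMap, ← φ.fromSpecStalkOfMem_restrict hW hWl hxW,
    ← ψ.fromSpecStalkOfMem_restrict hW hWr hxW]
  exact congrArg (W.fromSpecStalkOfMem x hxW ≫ ·) e

theorem genericMap_precompPartial (φ : X.PartialMap Y) (g : X ⟶ X) [IsIso g] {x x' : X}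
    (hx : x ∈ genericPoints X) (hx' : x' ∈ genericPoints X)
    (θ : X.presheaf.stalk x' ⟶ X.presheaf.stalk x)
    (hθ : Spec.map θ ≫ X.fromSpecStalk x' = X.fromSpecStalk x ≫ g) :
    Spec.map θ ≫ genericMap φ hx' = genericMap (precompPartial g φ) hx := by
  have h : ∀ (h₁ : x ∈ g ⁻¹ᵁ φ.domain) (h₂ : x' ∈ φ.domain),
      Spec.map θ ≫ φ.domain.fromSpecStalkOfMem x' h₂ =
        (g ⁻¹ᵁ φ.domain).fromSpecStalkOfMem x h₁ ≫ (g ∣_ φ.domain) := by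
    intro h₁ h₂
    rw [← cancel_mono φ.domain.ι, Category.assoc, Category.assoc, morphismRestrict_ι,
      Scheme.Opens.fromSpecStalkOfMem_ι, hθ, ← Category.assoc, Scheme.Opens.fromSpecStalkOfMem_ι]
  have h₁ := mem_of_mem_genericPoints hx (precompPartial g φ).domain.2
    (precompPartial g φ).dense_domain
  have h₂ := mem_of_mem_genericPoints hx' φ.domain.2 φ.dense_domain
  change Spec.map θ ≫ φ.domain.fromSpecStalkOfMem x' h₂ ≫ φ.hom =
    (g ⁻¹ᵁ φ.domain).fromSpecStalkOfMem x h₁ ≫ (g ∣_ φ.domain) ≫ φ.hom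
  rw [← Category.assoc, h h₁ h₂, Category.assoc]

end GenericMaps

/-! ### From local rings to varieties -/

/-- The statement of `exists_subgroup_fixing_points` for the local ring of `Y` at the fixed smooth point
`y` and the local ring, assumed to be a field, of `X` at a fixed point `x`, i.e. the function field of
a component of `X`. An equivariant rational map from `X` enters as an equivariant morphism from the
spectrum of this field; as `θ` is determined by `g`, the condition quantified over `θ` concerns a
single homomorphism for each `g`. -/
theorem exists_subgroup_fixing_points_of_genericMap {k : Type u} [Field k] [IsAlgClosed k]
    [CharZero k] {G : Type v} [CommGroup G] [Finite G] {X Y : Scheme.{u}}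
    (sX : X ⟶ Spec (.of k)) (sY : Y ⟶ Spec (.of k)) (aX : G → (X ⟶ X)) (aY : G → (Y ⟶ Y))
    (haX1 : aX 1 = 𝟙 X) (haX : ∀ g h, aX (g * h) = aX g ≫ aX h) (hsX : ∀ g, aX g ≫ sX = sX)
    (hsY : ∀ g, aY g ≫ sY = sY) [IsIntegral Y] [IsLocallyNoetherian Y]
    (y : Spec (.of k) ⟶ Y) (hy : y ≫ sY = 𝟙 _) (hyfix : ∀ g, y ≫ aY g = y)
    (U : Y.Opens) (hyU : y (closedPoint k) ∈ U) [Smooth (U.ι ≫ sY)]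
    (x : X) (hxL : IsField (X.presheaf.stalk x)) (hx : ∀ g, aX g x = x)
    (F : Spec (X.presheaf.stalk x) ⟶ Y) (hF : F ≫ sY = X.fromSpecStalk x ≫ sX)
    (hFeq : ∀ (g : G) (θ : X.presheaf.stalk x ⟶ X.presheaf.stalk x),
      Spec.map θ ≫ X.fromSpecStalk x = X.fromSpecStalk x ≫ aX g → Spec.map θ ≫ F = F ≫ aY g)
    (ι : Y.presheaf.stalk (genericPoint Y) ⟶ X.presheaf.stalk x)
    (hι : Spec.map ι ≫ Y.fromSpecStalk _ = F) (q c : ℕ) (hc : ¬ q ∣ c * degreeOf ι) :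
    ∃ G' : Subgroup G, ¬ q ∣ c * G'.index ∧
      ∀ (Z : Scheme.{u}) (s : Z ⟶ Spec (.of k)) [IsProper s] (ρ : G → (Z ⟶ Z))
        (_ : ∀ g, ρ g ≫ s = s) (φ : Spec (X.presheaf.stalk x) ⟶ Z)
        (_ : φ ≫ s = X.fromSpecStalk x ≫ sX)
        (_ : ∀ (g : G) (θ : X.presheaf.stalk x ⟶ X.presheaf.stalk x),
          Spec.map θ ≫ X.fromSpecStalk x = X.fromSpecStalk x ≫ aX g → Spec.map θ ≫ φ = φ ≫ ρ g),
        ∃ z : Spec (.of k) ⟶ Z, z ≫ s = 𝟙 _ ∧ ∀ g ∈ G', z ≫ ρ g = z := by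
  set y₀ : Y := y (closedPoint k)
  let R := Y.presheaf.stalk y₀
  let L := X.presheaf.stalk x
  let K := Y.functionField
  let jL : Spec L ⟶ X := X.fromSpecStalk x
  let jR : Spec R ⟶ Y := Y.fromSpecStalk y₀
  let e : R ⟶ .of k := Scheme.stalkClosedPointTo y
  have he : Spec.map e ≫ jR = y := Scheme.Spec_stalkClosedPointTo_fromSpecStalk y
  have hspec : genericPoint Y ⤳ y₀ := genericPoint_specializes y₀
  let γ : R ⟶ K := Y.presheaf.stalkSpecializes hspec
  have hγ : Spec.map γ ≫ jR = Y.fromSpecStalk _ :=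
    Scheme.SpecMap_stalkSpecializes_fromSpecStalk hspec
  have hγι : Spec.map (γ ≫ ι) ≫ jR = F := by
    rw [Spec.map_comp, Category.assoc, hγ, hι]
  let kL : CommRingCat.of k ⟶ L := Spec.preimage (jL ≫ sX)
  have hkL : Spec.map kL = jL ≫ sX := Spec.map_preimage _
  let kR : CommRingCat.of k ⟶ R := Spec.preimage (jR ≫ sY)
  have hkR : Spec.map kR = jR ≫ sY := Spec.map_preimage _
  have hkRL : kR ≫ γ ≫ ι = kL := Spec.map_injective <| by
    rw [Spec.map_comp, hkR, hkL, ← Category.assoc, hγι, hF]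
  have hkRe : kR ≫ e = 𝟙 _ := Spec.map_injective <| by
    rw [Spec.map_comp, hkR, ← Category.assoc, he, hy, Spec.map_id]
  -- the actions of `G` on the local rings
  choose θ hθ _ using fun g ↦ exists_stalk_hom (aX g) (hx g)
  have hyy (g : G) : aY g y₀ = y₀ :=
    congrArg (fun f : Spec (.of k) ⟶ Y ↦ f (closedPoint k)) (hyfix g)
  choose η hη _ using fun g ↦ exists_stalk_hom (aY g) (hyy g)
  have hθ1 : θ 1 = 𝟙 L := stalk_hom_ext <| by
    rw [hθ, haX1, Spec.map_id, Category.comp_id, Category.id_comp]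
  have hθm (g h : G) : θ (g * h) = θ h ≫ θ g := stalk_hom_ext <| by
    rw [hθ, haX, Spec.map_comp, Category.assoc, hθ h, ← Category.assoc, ← Category.assoc, hθ g]
  have hθk (g : G) : kL ≫ θ g = kL := Spec.map_injective <| by
    rw [Spec.map_comp, hkL, ← Category.assoc, hθ, Category.assoc, hsX]
  have hηk (g : G) : kR ≫ η g = kR := Spec.map_injective <| by
    rw [Spec.map_comp, hkR, ← Category.assoc, hη, Category.assoc, hsY]
  have hηθ (g : G) : η g ≫ γ ≫ ι = (γ ≫ ι) ≫ θ g := stalk_hom_ext <| by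
    rw [Spec.map_comp, Category.assoc, hη, ← Category.assoc, hγι, Spec.map_comp (γ ≫ ι),
      Category.assoc, hγι]
    exact (hFeq g _ (hθ g)).symm
  -- the algebra structures
  let : Field L := hxL.toField
  let : Algebra k R := kR.hom.toAlgebra
  let : Algebra k L := kL.hom.toAlgebra
  let : Algebra R L := (γ ≫ ι).hom.toAlgebra
  let : Algebra K L := ι.hom.toAlgebra
  have : IsScalarTower k R L := .of_algebraMap_eq' (congrArg CommRingCat.Hom.hom hkRL).symm
  have : IsScalarTower R K L := .of_algebraMap_eq' rfl
  let ε : R →ₐ[k] k :=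
    { e.hom with commutes' := fun a ↦ RingHom.congr_fun (congrArg CommRingCat.Hom.hom hkRe) a }
  let τ : G →* (L →ₐ[k] L) :=
    { toFun g :=
        { (θ g).hom with
          commutes' := fun a ↦ RingHom.congr_fun (congrArg CommRingCat.Hom.hom (hθk g)) a }
      map_one' := AlgHom.ext fun a ↦ RingHom.congr_fun (congrArg CommRingCat.Hom.hom hθ1) a
      map_mul' g h := AlgHom.ext fun a ↦
        RingHom.congr_fun (congrArg CommRingCat.Hom.hom (hθm g h)) a }
  let σ (g : G) : R →ₐ[k] R :=
    { (η g).hom with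
      commutes' := fun a ↦ RingHom.congr_fun (congrArg CommRingCat.Hom.hom (hηk g)) a }
  have hsmooth : Algebra.FormallySmooth k R :=
    formallySmooth_preimage_fromSpecStalk_of_mem sY y₀ U hyU
  have hT : TangentVectorsLift k R := .of_projective ε
  obtain ⟨n, f, hf⟩ := Submodule.fg_iff_exists_fin_generating_family.mp
    (maximalIdeal R).fg_of_isNoetherianRing
  obtain ⟨G', hG', hZ⟩ := exists_subgroup_fixing_points q n G R K L ε hT ⟨f, hf.symm⟩ τ σ
    (fun g r ↦ RingHom.congr_fun (congrArg CommRingCat.Hom.hom (hηθ g)) r) c hc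
  refine ⟨G', hG', fun Z s _ ρ hρ φ hφ heq ↦ ?_⟩
  exact hZ Z s ρ hρ φ (hφ.trans hkL.symm) fun g ↦ heq g (θ g) (hθ g)

/-! ### Equivariant rational maps -/

section Equivariant

variable {k : Type u} [Field k] {H : Type v} [CommGroup H] {X Y : GVariety k H}

theorem isLocallyNoetherian_scheme (X : GVariety k H) : IsLocallyNoetherian X.scheme := by
  have := X.isVariety.locallyOfFiniteType
  have : LocallyOfFiniteType (Y := Spec (.of k)) X.obj.hom := this
  exact LocallyOfFiniteType.isLocallyNoetherian (Y := Spec (.of k)) X.obj.hom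

theorem noetherianSpace_scheme (X : GVariety k H) :
    TopologicalSpace.NoetherianSpace X.scheme := by
  have := isLocallyNoetherian_scheme X
  have : QuasiCompact (Y := Spec (.of k)) X.obj.hom := X.isVariety.quasiCompact
  have : CompactSpace X.scheme :=
    (quasiCompact_iff_compactSpace (Y := Spec (.of k)) (f := X.obj.hom)).mp this
  have : IsNoetherian X.scheme := {}
  infer_instance

/-- Composition in diagrammatic order reverses products, which is immaterial for commutative `H`. -/
theorem act_left_mul (X : GVariety k H) (g h : H) :
    (X.act (g * h)).left = (X.act g).left ≫ (X.act h).left := by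
  rw [mul_comm, GVariety.act, map_mul]
  rfl

theorem act_left_one (X : GVariety k H) : (X.act 1).left = 𝟙 X.scheme := by
  rw [GVariety.act, map_one]
  rfl

theorem act_left_hom (X : GVariety k H) (h : H) : (X.act h).left ≫ X.obj.hom = X.obj.hom :=
  Over.w (X.act h)

variable [TopologicalSpace.NoetherianSpace X.scheme] {f : X.scheme ⤏ Y.scheme}

theorem genericMap_representative_comp_hom (hf : GVariety.IsRationalMap X Y f) {x : X.scheme}
    (hx : x ∈ genericPoints X.scheme) :
    genericMap f.representative hx ≫ Y.obj.hom = X.scheme.fromSpecStalk x ≫ X.obj.hom := by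
  have h := hf.isOver
  rw [← f.toRationalMap_representative, ← Scheme.RationalMap.compHom_toRationalMap] at h
  have h2 := genericMap_eq_of_equiv (Scheme.PartialMap.toRationalMap_eq_iff.mp h) hx
  rw [genericMap, genericMap, Scheme.PartialMap.fromSpecStalkOfMem_compHom] at h2
  exact h2.trans (Scheme.PartialMap.fromSpecStalkOfMem_toPartialMap _ _)

theorem genericMap_representative_comp_act (hf : GVariety.IsRationalMap X Y f) (h : H)
    {x x' : X.scheme} (hx : x ∈ genericPoints X.scheme) (hx' : x' ∈ genericPoints X.scheme)
    (θ : X.scheme.presheaf.stalk x' ⟶ X.scheme.presheaf.stalk x)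
    (hθ : Spec.map θ ≫ X.scheme.fromSpecStalk x' = X.scheme.fromSpecStalk x ≫ (X.act h).left) :
    Spec.map θ ≫ genericMap f.representative hx' =
      genericMap f.representative hx ≫ (Y.act h).left := by
  have h1 := hf.equivariant h
  rw [← f.toRationalMap_representative, ← Scheme.RationalMap.compHom_toRationalMap] at h1
  have h2 : (precompPartial (X.act h).left f.representative).equiv
      (f.representative.compHom (Y.act h).left) := Scheme.PartialMap.toRationalMap_eq_iff.mp h1
  rw [genericMap_precompPartial _ _ hx hx' θ hθ, genericMap_eq_of_equiv h2, genericMap, genericMap,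
    Scheme.PartialMap.fromSpecStalkOfMem_compHom]

end Equivariant

/-! ### The degree as a sum over generic points -/

section Degree

variable {X Y : Scheme.{u}} [TopologicalSpace.NoetherianSpace X] [IrreducibleSpace Y]

/-- The components of `X` which dominate `Y` under the partial map `φ`, each given by its generic
point `x`: the condition is that `φ` maps `x` to the generic point of `Y`, in the form that the
restriction of `φ` to the local ring at `x` comes from a homomorphism of local rings. -/
def DominatingPoint (φ : X.PartialMap Y) : Type u :=
  {x : X // ∃ (hx : x ∈ genericPoints X)
    (ι : Y.presheaf.stalk (genericPoint Y) ⟶ X.presheaf.stalk x),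
    Spec.map ι ≫ Y.fromSpecStalk (genericPoint Y) = genericMap φ hx}

namespace DominatingPoint

variable {φ : X.PartialMap Y} (x : DominatingPoint φ)

theorem mem_genericPoints : x.1 ∈ genericPoints X := x.2.choose

/-- The homomorphism `k(Y) ⟶ k(Xᵢ)`, for reduced schemes an extension of function fields. -/
def stalkHom : Y.presheaf.stalk (genericPoint Y) ⟶ X.presheaf.stalk x.1 := x.2.choose_spec.choose

theorem specMap_stalkHom :
    Spec.map x.stalkHom ≫ Y.fromSpecStalk (genericPoint Y) = genericMap φ x.mem_genericPoints :=
  x.2.choose_spec.choose_spec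

end DominatingPoint

/-- The generic points of the domain of `φ` are those of `X`, with the same local rings. -/
theorem partialDegree_eq_finsum (φ : X.PartialMap Y) :
    partialDegree φ = ∑ᶠ x : DominatingPoint φ, degreeOf x.stalkHom := by
  let U := φ.domain
  have hmem (ξ : U.toScheme) (h : ξ ∈ genericPoints U.toScheme) : U.ι ξ ∈ genericPoints X :=
    (mem_genericPoints_iff_of_isOpenEmbedding U.ι.isOpenEmbedding).mp h
  have hgen (ξ : U.toScheme) (h : U.ι ξ ∈ genericPoints X) :
      genericMap φ h = Spec.map (inv (U.ι.stalkMap ξ)) ≫ U.toScheme.fromSpecStalk ξ ≫ φ.hom := by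
    rw [← Category.assoc, ← fromSpecStalkOfMem_eq]
    rfl
  have hex (ξ : U.toScheme) (h : ξ ∈ genericPoints U.toScheme) (hη : φ.hom ξ = genericPoint Y) :
      ∃ ι : Y.presheaf.stalk (genericPoint Y) ⟶ X.presheaf.stalk (U.ι ξ),
        Spec.map ι ≫ Y.fromSpecStalk (genericPoint Y) = genericMap φ (hmem ξ h) := by
    obtain ⟨θ, hθ, -⟩ := exists_stalk_hom φ.hom hη
    refine ⟨θ ≫ inv (U.ι.stalkMap ξ), ?_⟩
    rw [Spec.map_comp, Category.assoc, hθ, hgen]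
  let e : {ξ : U.toScheme // ξ ∈ genericPoints U.toScheme ∧ φ.hom ξ = genericPoint Y} →
      DominatingPoint φ := fun ξ ↦ ⟨U.ι ξ.1, hmem ξ.1 ξ.2.1, hex ξ.1 ξ.2.1 ξ.2.2⟩
  refine finsum_eq_of_bijective e ⟨fun ξ ξ' h ↦ ?_, fun x ↦ ?_⟩ fun ξ ↦ ?_
  · exact Subtype.ext (U.ι.isOpenEmbedding.injective (congrArg (fun x : DominatingPoint φ ↦ x.1) h))
  · obtain ⟨x, hx, ι, hι⟩ := x
    obtain ⟨ξ, rfl⟩ : ∃ ξ : U.toScheme, U.ι ξ = x :=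
      ⟨⟨x, mem_of_mem_genericPoints hx U.2 φ.dense_domain⟩, rfl⟩
    refine ⟨⟨ξ, (mem_genericPoints_iff_of_isOpenEmbedding U.ι.isOpenEmbedding).mpr hx, ?_⟩, rfl⟩
    have h1 : Spec.map (U.ι.stalkMap ξ) ≫ genericMap φ hx =
        U.toScheme.fromSpecStalk ξ ≫ φ.hom := by
      rw [hgen, ← Category.assoc, ← Spec.map_comp, IsIso.inv_hom_id, Spec.map_id,
        Category.id_comp]
    have h2 : φ.hom ξ = Y.fromSpecStalk (genericPoint Y)
        (Spec.map (ι ≫ U.ι.stalkMap ξ) (closedPoint (U.toScheme.presheaf.stalk ξ))) := by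
      have h3 : Spec.map (ι ≫ U.ι.stalkMap ξ) ≫ Y.fromSpecStalk (genericPoint Y) =
          U.toScheme.fromSpecStalk ξ ≫ φ.hom := by
        rw [Spec.map_comp, Category.assoc, ← h1]
        exact congrArg _ hι
      have h4 := congrArg (fun a : Spec (U.toScheme.presheaf.stalk ξ) ⟶ Y ↦ a (closedPoint _)) h3
      refine (congrArg φ.hom (Scheme.fromSpecStalk_closedPoint (x := ξ)).symm).trans h4.symm
    rw [h2]
    refine (Specializes.antisymm ?_ (genericPoint_specializes _)).eq
    have h5 := (specializes_closedPoint (Spec.map (ι ≫ U.ι.stalkMap ξ)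
      (closedPoint (U.toScheme.presheaf.stalk ξ)))).map
        (Y.fromSpecStalk (genericPoint Y)).continuous
    rwa [Scheme.fromSpecStalk_closedPoint] at h5
  · obtain ⟨ξ, h, hη⟩ := ξ
    obtain ⟨θ, hθ, hθ'⟩ := exists_stalk_hom (𝟙 Y) (x := genericPoint Y) (y := φ.hom ξ) hη.symm
    have := hθ' inferInstance
    refine degreeOf_eq_of_isIso (φ.hom.stalkMap ξ) (e ⟨ξ, h, hη⟩).stalkHom θ
      (inv (U.ι.stalkMap ξ)) (stalk_hom_ext ?_)
    rw [Spec.map_comp, Category.assoc, Scheme.SpecMap_stalkMap_fromSpecStalk, Spec.map_comp,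
      Category.assoc, hθ, Category.comp_id, DominatingPoint.specMap_stalkHom]
    exact (hgen ξ _).symm

end Degree

/-! ### The action on the components dominating the target -/

section Action

variable {k : Type u} [Field k] {H : Type v} [CommGroup H] {X Y : GVariety k H}
  [TopologicalSpace.NoetherianSpace X.scheme] [IrreducibleSpace Y.scheme]
  {f : X.scheme ⤏ Y.scheme}

/-- Compatibility of the stalk homomorphism with automorphisms of source and target. -/
theorem exists_stalkHom_act (hf : GVariety.IsRationalMap X Y f) (h : H)
    (x : DominatingPoint f.representative) :
    ∃ (hx' : (X.act h).left x.1 ∈ genericPoints X.scheme)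
      (ι' : Y.scheme.presheaf.stalk (genericPoint Y.scheme) ⟶
        X.scheme.presheaf.stalk ((X.act h).left x.1)),
      Spec.map ι' ≫ Y.scheme.fromSpecStalk _ = genericMap f.representative hx' ∧
        degreeOf x.stalkHom = degreeOf ι' := by
  have hx' : (X.act h).left x.1 ∈ genericPoints X.scheme :=
    homeomorph_mem_genericPoints (X.act h).left.homeomorph x.mem_genericPoints
  obtain ⟨θ, hθ, hθ'⟩ := exists_stalk_hom (X.act h).left (x := x.1) rfl
  have := hθ' inferInstance
  obtain ⟨η, hη, hη'⟩ := exists_stalk_hom (Y.act h).left (x := genericPoint Y.scheme)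
    (genericPoint_eq_of_isOpenImmersion (Y.act h).left)
  have := hη' inferInstance
  refine ⟨hx', η ≫ x.stalkHom ≫ inv θ, ?_, ?_⟩
  · have h1 := genericMap_representative_comp_act hf h x.mem_genericPoints hx' θ hθ
    rw [← cancel_epi (Spec.map θ), h1, ← Category.assoc, ← Spec.map_comp, Category.assoc,
      Category.assoc, IsIso.inv_hom_id, Category.comp_id, Spec.map_comp, Category.assoc, hη,
      ← Category.assoc, x.specMap_stalkHom]
  · refine degreeOf_eq_of_isIso _ _ (inv η) (inv θ) ?_
    rw [IsIso.inv_hom_id_assoc]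

/-- The action on the components dominating the target of an equivariant rational map. -/
abbrev dominatingPointAction (hf : GVariety.IsRationalMap X Y f) :
    MulAction H (DominatingPoint f.representative) where
  smul h x := ⟨(X.act h).left x.1, (exists_stalkHom_act hf h x).choose,
    (exists_stalkHom_act hf h x).choose_spec.choose,
    (exists_stalkHom_act hf h x).choose_spec.choose_spec.1⟩
  one_smul x := Subtype.ext <| by
    change (X.act 1).left x.1 = x.1
    rw [act_left_one]
    rfl
  -- `act_left_mul` composes in the opposite order, hence `mul_comm`
  mul_smul g h x := Subtype.ext <| by
    change (X.act (g * h)).left x.1 = (X.act g).left ((X.act h).left x.1)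
    rw [mul_comm, act_left_mul]
    rfl

theorem degreeOf_stalkHom_smul (hf : GVariety.IsRationalMap X Y f) (h : H)
    (x : DominatingPoint f.representative) :
    letI := dominatingPointAction hf
    degreeOf (h • x).stalkHom = degreeOf x.stalkHom := by
  let := dominatingPointAction hf
  obtain ⟨hx', ι', h1, h2⟩ := exists_stalkHom_act hf h x
  rw [h2]
  exact congrArg degreeOf (stalk_hom_ext ((h • x).specMap_stalkHom.trans h1.symm))

end Action

theorem zpow_sub_le_card_of_not_dvd_index {H : Type*} [Group H] {p n e : ℕ} (hp : p.Prime)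
    (hH : Nat.card H = p ^ n) (H' : Subgroup H) (h : ¬ p ^ (e + 1) ∣ H'.index) :
    (p : ℚ) ^ ((n : ℤ) - (e : ℤ)) ≤ (Nat.card H' : ℚ) := by
  obtain ⟨m, hm, hi⟩ := (Nat.dvd_prime_pow hp).mp (hH ▸ H'.index_dvd_card)
  have hme : m ≤ e := by
    by_contra! hlt
    exact h (hi ▸ pow_dvd_pow p hlt)
  have hp0 : (p : ℚ) ≠ 0 := by exact_mod_cast hp.ne_zero
  have hc : (Nat.card H' : ℚ) * (p : ℚ) ^ m = (p : ℚ) ^ n := by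
    exact_mod_cast hi ▸ hH ▸ H'.card_mul_index
  have hc' : (Nat.card H' : ℚ) = (p : ℚ) ^ ((n : ℤ) - (m : ℤ)) := by
    rw [zpow_sub₀ hp0, zpow_natCast, zpow_natCast, ← hc]
    field_simp
  rw [hc']
  exact zpow_le_zpow_right₀ (by exact_mod_cast hp.one_le) (by omega)

end GoingUp

end

theorem mainTheorem5 {k : Type u} [Field k] [IsAlgClosed k] [CharZero k]
    {H : Type v} [CommGroup H] (p n e : ℕ) (hp : p.Prime) (hH : Nat.card H = p ^ n)
    (X Y : GoingUp.GVariety k H) (f : X.scheme ⤏ Y.scheme)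
    (hf : GoingUp.GVariety.IsRationalMap X Y f) (hdom : f.IsDominant)
    [IrreducibleSpace Y.scheme] (hX : X.IsComplete)
    (hdim : topologicalKrullDim X.scheme = topologicalKrullDim Y.scheme)
    (hfix : ∃ y : Y.Point, Y.IsSmoothAt y ∧ Y.IsFixedBy ⊤ y)
    (hdeg : ¬ p ^ (e + 1) ∣ GoingUp.degree f) :
    ∃ H' : Subgroup H, (p : ℚ) ^ ((n : ℤ) - (e : ℤ)) ≤ (Nat.card H' : ℚ) ∧
      (∃ x : X.Point, X.IsFixedBy H' x) ∧
      ∀ (Z : GoingUp.GVariety k H) (g : X.scheme ⤏ Z.scheme), Z.IsComplete →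
        GoingUp.GVariety.IsRationalMap X Z g → ∃ z : Z.Point, Z.IsFixedBy H' z := by
  open GoingUp in
  have : Finite H := Nat.finite_of_card_ne_zero (hH ▸ pow_ne_zero n hp.ne_zero)
  have := noetherianSpace_scheme X
  have := isLocallyNoetherian_scheme Y
  have : IsReduced X.scheme := X.isVariety.isReduced
  have : IsReduced Y.scheme := Y.isVariety.isReduced
  have : IsIntegral Y.scheme := isIntegral_of_irreducibleSpace_of_isReduced _
  obtain ⟨y, ⟨U, hyU, hU⟩, hy⟩ := hfix
  let := dominatingPointAction hf
  rw [degree, partialDegree_eq_finsum, ← one_mul (finsum _)] at hdeg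
  obtain ⟨x, hx⟩ := exists_not_dvd_index_stabilizer_mul (G := H)
    (fun x : DominatingPoint f.representative ↦ degreeOf x.stalkHom)
    (degreeOf_stalkHom_smul hf) _ _ hdeg
  rw [one_mul] at hx
  let S := MulAction.stabilizer H x
  have hfixx (g : S) : (X.act g).left x.1 = x.1 :=
    congrArg (fun x : DominatingPoint f.representative ↦ x.1)
      g.2
  obtain ⟨G', hG', hZ⟩ := exists_subgroup_fixing_points_of_genericMap X.obj.hom Y.obj.hom
    (fun g : S ↦ (X.act g).left) (fun g : S ↦ (Y.act g).left) (act_left_one X)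
    (fun g h ↦ act_left_mul X g h) (fun g ↦ act_left_hom X g) (fun g ↦ act_left_hom Y g)
    y.left (Over.w y) (fun g ↦ congrArg CommaMorphism.left (hy g (Subgroup.mem_top _))) U hyU
    x.1 (isField_stalk_of_mem_genericPoints x.mem_genericPoints) hfixx
    (genericMap f.representative x.mem_genericPoints)
    (genericMap_representative_comp_hom hf x.mem_genericPoints)
    (fun g θ hθ ↦ genericMap_representative_comp_act hf g _ _ θ hθ)
    x.stalkHom x.specMap_stalkHom _ _ hx
  -- both claims are instances of the following, applied to the identity of `X` and to the given map
  have key (Z : GVariety k H) (hZp : Z.IsComplete)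
      (φ : Spec (X.scheme.presheaf.stalk x.1) ⟶ Z.scheme)
      (hφ : φ ≫ Z.obj.hom = X.scheme.fromSpecStalk x.1 ≫ X.obj.hom)
      (hφ' : ∀ (g : H) (θ : X.scheme.presheaf.stalk x.1 ⟶ X.scheme.presheaf.stalk x.1),
        Spec.map θ ≫ X.scheme.fromSpecStalk x.1 = X.scheme.fromSpecStalk x.1 ≫ (X.act g).left →
          Spec.map θ ≫ φ = φ ≫ (Z.act g).left) :
      ∃ z : Z.Point, Z.IsFixedBy (G'.map S.subtype) z := by
    have : IsProper (Y := Spec (.of k)) Z.obj.hom := hZp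
    obtain ⟨z, hz, hz'⟩ := hZ Z.scheme Z.obj.hom (fun g ↦ (Z.act g).left)
      (fun g ↦ act_left_hom Z g) φ hφ fun g ↦ hφ' g
    refine ⟨Over.homMk z hz, ?_⟩
    rintro _ ⟨g, hg, rfl⟩
    exact Over.OverMorphism.ext (hz' g hg)
  refine ⟨G'.map S.subtype, ?_, ?_, ?_⟩
  · refine zpow_sub_le_card_of_not_dvd_index hp hH _ ?_
    rwa [Subgroup.index_map_subtype, mul_comm]
  · exact key X hX _ rfl fun g θ hθ ↦ hθ
  · intro Z g hZc hg
    exact key Z hZc (genericMap g.representative x.mem_genericPoints)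
      (genericMap_representative_comp_hom hg _)
      fun h θ hθ ↦ genericMap_representative_comp_act hg h _ _ θ hθ
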